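/- **Twelve Cartan invariants for 3D Szekeres spacetimes.** Let $\Lambda\in\mathbb R$ and let $A,B,C,F,S$ be smooth functions of $y$. Put $R(t,y)=\mathrm{ch}_\Lambda(t)+F(y)\,\mathrm{sh}_\Lambda(t)$ with $\mathrm{ch}_\Lambda(t)=\cosh(\sqrt\Lambda\,t)$ and $\mathrm{sh}_\Lambda(t)=\sinh(\sqrt\Lambda\,t)/\sqrt\Lambda$ (read as $1,\ t$ if $\Lambda=0$ and as $\cos(\sqrt{-\Lambda}\,t)$, $\sin(\sqrt{-\Lambda}\,t)/\sqrt{-\Lambda}$ if $\Lambda<0$), $\hat\nu(x,y)=-\ln(A(y)x^2+2B(y)x+C(y))$ and $W=R_{,y}+R\,\hat\nu_{,y}$. The 3D Szekeres spacetime (comoving dust with cosmological constant $\Lambda$) is the metric $$ds^2=-dt^2+R^2e^{2\hat\nu}dx^2+\frac{W^2}{S^2F_{,y}^2}\,dy^2$$ on an open set $U$ of points $(t,x,y)$ on which $A x^2+2Bx+C>0$ and $F_{,y}$, $S$, $R$, $W$ do not vanish. Use the triad $\ell=\tfrac12\big(\partial_t-\tfrac{1}{Re^{\hat\nu}}\partial_x\big)$,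 $m=\tfrac{SF_{,y}}{2W}\partial_y$, $n=\tfrac12\big(\partial_t+\tfrac{1}{Re^{\hat\nu}}\partial_x\big)$, write $D,\delta,\Delta$ for the derivatives along $\ell,m,n$ (on scalars, and covariantly on vectors), and define spin coefficients by $D\ell=2\epsilon\ell-2\kappa m$, $Dn=-2\epsilon n+2\pi m$, $\delta\ell=2\alpha\ell-2\sigma m$, $\delta n=-2\alpha n+2\lambda m$, $\Delta\ell=2\gamma\ell-2\tau m$, $\Delta n=-2\gamma n+2\nu m$. Let $S_{ab}$ be the trace-free Ricci tensor, $\Psi_0=S(\ell,\ell)$, $\Psi_1=S(\ell,m)$, $\Psi_2=S(m,m)$, $\Psi_3=S(m,n)$, $\Psi_4=S(n,n)$. The Cartan invariants of order $k$ are the components of $\nabla^k\mathrm{Riem}$ in this triad. By the extended Cartan invariants up to second order we mean: the Cartan invariants of order $0,1,2$; $\Lambda$ and $\Psi_0,\dots,\Psi_4$ (order 0); $\gamma$, $\epsilon$, $\sigma-\lambda$ and the frame derivatives of $\Psi_2$ (order 1); all the other spin coefficients, the frame derivatives of $\gamma$ and $\sigma-\lambda$, and the second frame derivatives of $\Psi_2$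 (order 2). Let $t_q(p)$ be the rank at $p$ of the differentials of the Cartan invariants of order at most $q$, and $H_q(p)$ the group of Lorentz transformations of the tangent space at $p$ that preserve $\nabla^k\mathrm{Riem}$ for all $k\le q$. The Cartan–Karlhede algorithm stops at the first $q\ge1$ with $t_q=t_{q-1}$ and $\dim H_q=\dim H_{q-1}$. Then: 1. On $U$ the triad is in normal form: $\Psi_0=\Psi_4=3\Psi_2$, $\Psi_1=\Psi_3=0$, $\kappa=\pi=-\tau=-\nu$, $\epsilon=-\gamma$, $\alpha=0$. At every point where $\Psi_2\neq0$ (non-zero dust density), the trace-free Ricci tensor has Segre type $\{1(1,1)\}$ (a timelike eigenvector, and a degenerate spacelike eigenplane with a different eigenvalue), and $\dim H_0=1$, $\dim H_1=\dim H_2=0$. 2. If $\Psi_2\ne0$, $t_0=1$ and $t_1=3$ everywhere on $U$ (the generic case), then $t_2=3$, so the invariant count is $(1,3,3)$, and the Cartan–Karlhede algorithm stops at second order, $q=2$. 3. Every extended Cartan invariant up to second order is a polynomial, with rational coefficients that are the same for all 3D Szekeres spacetimes, in the following twelve: $\Lambda,\ \Psi_2$ (order 0); $\gamma,\ \sigma-\lambda,\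 \delta\Psi_2,\ \Delta\Psi_2$ (order 1); $\pi,\ \sigma+\lambda,\ \delta(\sigma-\lambda),\ \delta\delta\Psi_2,\ \Delta\Delta\Psi_2,\ \Delta\delta\Psi_2$ (order 2). Those of order 0 need only the first two, those of order at most 1 only the first six. 4. Conversely, at points where $\Psi_2\neq0$ each of these twelve is a rational function (a quotient of polynomials over $\mathbb Q$, the same for all such spacetimes, with non-vanishing denominator) of the Cartan invariants up to its own order. 5. Consequently at most twelve extended Cartan invariants up to second order are algebraically independent: no thirteen of them are algebraically independent over $\mathbb Q$ as functions on $U$. -/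

import Mathlib

open scoped ContDiff

noncomputable section

namespace Szekeres3D

/-! ## Tensor calculus on open subsets of `ℝ³`, in coordinates -/

/-- Coordinate points; in the spacetimes below the coordinates `0, 1, 2` are `t, x, y`. -/
abbrev Pt := Fin 3 → ℝ

/-- A field of covariant tensors of rank `n`, given by its coordinate components. -/
abbrev TensorField (n : ℕ) := Pt → (Fin n → Fin 3) → ℝ

/-- The coordinate partial derivative `∂ᵢ f`. -/
def pd (i : Fin 3) (f : Pt → ℝ) (p : Pt) : ℝ := fderiv ℝ f p (Pi.single i 1)

section Metric

variable (g : Pt → Matrix (Fin 3) (Fin 3) ℝ)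

/-- The Christoffel symbols `Γᵏᵢⱼ` of the Levi-Civita connection of `g`. -/
def christoffel (k i j : Fin 3) (p : Pt) : ℝ :=
  (1 / 2) * ∑ l, (g p)⁻¹ k l *
    (pd i (fun q => g q j l) p + pd j (fun q => g q i l) p - pd l (fun q => g q i j) p)

/-- The curvature tensor `Rᵃ_bcd = ∂_c Γᵃ_db - ∂_d Γᵃ_cb + Γᵃ_ce Γᵉ_db - Γᵃ_de Γᵉ_cb`. -/
def riemannUp (a b c d : Fin 3) (p : Pt) : ℝ :=
  pd c (christoffel g a d b) p - pd d (christoffel g a c b) p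
    + ∑ e, (christoffel g a c e p * christoffel g e d b p
      - christoffel g a d e p * christoffel g e c b p)

/-- The covariant curvature tensor `R_abcd`. -/
def riemann : TensorField 4 := fun p I =>
  ∑ e, g p (I 0) e * riemannUp g e (I 1) (I 2) (I 3) p

/-- The Ricci tensor `R_bd = Rᵃ_bad`. -/
def ricci (b d : Fin 3) (p : Pt) : ℝ := ∑ a, riemannUp g a b a d p

/-- The scalar curvature. -/
def scalarCurvature (p : Pt) : ℝ := ∑ a, ∑ b, (g p)⁻¹ a b * ricci g a b p

/-- The trace-free Ricci tensor `S_ab = R_ab - (R / 3) g_ab`. -/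
def traceFreeRicci (p : Pt) : Matrix (Fin 3) (Fin 3) ℝ :=
  fun a b => ricci g a b p - scalarCurvature g p / 3 * g p a b

/-- The covariant derivative `T_{a₁…aₙ;c}`; the new index `c` is the last one. -/
def covDeriv {n : ℕ} (T : TensorField n) : TensorField (n + 1) := fun p I =>
  pd (I (Fin.last n)) (fun q => T q (Fin.init I)) p
    - ∑ k : Fin n, ∑ d : Fin 3, christoffel g d (I (Fin.last n)) (Fin.init I k) p
        * T p (Function.update (Fin.init I) k d)

/-- The `k`-th covariant derivative `∇ᵏ Riem` of the curvature tensor. -/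
def curvatureDeriv : (k : ℕ) → TensorField (4 + k)
  | 0 => riemann g
  | k + 1 => covDeriv g (curvatureDeriv k)

/-- The pull-back of a covariant tensor at a point by a linear map of the tangent space. -/
def pullback {n : ℕ} (M : Matrix (Fin 3) (Fin 3) ℝ) (T : (Fin n → Fin 3) → ℝ) :
    (Fin n → Fin 3) → ℝ :=
  fun I => ∑ J : Fin n → Fin 3, T J * ∏ k, M (J k) (I k)

/-- The isotropy group `H_q` at `p`: the Lorentz transformations of the tangent space (linear maps
that preserve `g`) which preserve the curvature tensor and its covariant derivatives up to
order `q`. -/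
def isotropyGroup (q : ℕ) (p : Pt) : Set (Matrix (Fin 3) (Fin 3) ℝ) :=
  {M | M.transpose * g p * M = g p ∧
    ∀ k ≤ q, pullback M (curvatureDeriv g k p) = curvatureDeriv g k p}

/-- The dimension of the closed linear group `H_q`, that is, of its Lie algebra
`{A | exp (sA) ∈ H_q for all real s}`. -/
def isotropyDim (q : ℕ) (p : Pt) : ℕ :=
  Module.finrank ℝ (Submodule.span ℝ
    {A : Matrix (Fin 3) (Fin 3) ℝ | ∀ s : ℝ, NormedSpace.exp (s • A) ∈ isotropyGroup g q p})

/-- The trace-free Ricci tensor has Segre type `{1(1,1)}` at `p` (Petrov type DZ): as an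
endomorphism `Sᵃ_b` it has a timelike eigenvector `u`, it is a multiple `μ` of the identity on the
spacelike plane orthogonal to `u`, and the two eigenvalues (`-2μ` and `μ`, as the trace
vanishes) are different. -/
def IsSegreDZ (p : Pt) : Prop :=
  ∃ (u : Fin 3 → ℝ) (μ : ℝ), u ⬝ᵥ (g p).mulVec u < 0 ∧ μ ≠ 0 ∧
    ((g p)⁻¹ * traceFreeRicci g p).mulVec u = (-2 * μ) • u ∧
    ∀ v : Fin 3 → ℝ, u ⬝ᵥ (g p).mulVec v = 0 →
      ((g p)⁻¹ * traceFreeRicci g p).mulVec v = μ • v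

end Metric

/-! ## The Szekeres metrics -/

/-- `ch_Λ(t) = cosh (√Λ t)`, read as `cos (√(-Λ) t)` for `Λ < 0`. -/
def chL (Λ t : ℝ) : ℝ :=
  if 0 ≤ Λ then Real.cosh (Real.sqrt Λ * t) else Real.cos (Real.sqrt (-Λ) * t)

/-- `sh_Λ(t) = sinh (√Λ t) / √Λ`, read as `t` for `Λ = 0` and as
`sin (√(-Λ) t) / √(-Λ)` for `Λ < 0`. -/
def shL (Λ t : ℝ) : ℝ :=
  if 0 < Λ then Real.sinh (Real.sqrt Λ * t) / Real.sqrt Λ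
  else if Λ = 0 then t
  else Real.sin (Real.sqrt (-Λ) * t) / Real.sqrt (-Λ)

/-- `R(t, y) = ch_Λ(t) + F(y) sh_Λ(t)`. -/
def scaleR (Λ : ℝ) (F : ℝ → ℝ) (t y : ℝ) : ℝ := chL Λ t + F y * shL Λ t

/-- `ν̂(x, y) = - ln (A(y) x² + 2 B(y) x + C(y))`. -/
def nuHat (A B C : ℝ → ℝ) (x y : ℝ) : ℝ := -Real.log (A y * x ^ 2 + 2 * B y * x + C y)

/-- `W = R_{,y} + R ν̂_{,y}`. -/
def scaleW (Λ : ℝ) (A B C F : ℝ → ℝ) (t x y : ℝ) : ℝ :=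
  deriv (fun z => scaleR Λ F t z) y + scaleR Λ F t y * deriv (fun z => nuHat A B C x z) y

/-- The data of a 3D Szekeres spacetime: a cosmological constant, the arbitrary functions of `y`,
and an open coordinate domain on which these functions are smooth and the metric is defined and
non-degenerate. -/
structure Spacetime where
  Λ : ℝ
  A : ℝ → ℝ
  B : ℝ → ℝ
  C : ℝ → ℝ
  F : ℝ → ℝ
  S : ℝ → ℝ
  U : Set Pt
  isOpen_U : IsOpen U
  smooth_A : ∀ p ∈ U, ContDiffAt ℝ ∞ A (p 2)
  smooth_B : ∀ p ∈ U, ContDiffAt ℝ ∞ B (p 2)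
  smooth_C : ∀ p ∈ U, ContDiffAt ℝ ∞ C (p 2)
  smooth_F : ∀ p ∈ U, ContDiffAt ℝ ∞ F (p 2)
  smooth_S : ∀ p ∈ U, ContDiffAt ℝ ∞ S (p 2)
  quad_pos : ∀ p ∈ U, 0 < A (p 2) * p 1 ^ 2 + 2 * B (p 2) * p 1 + C (p 2)
  dF_ne : ∀ p ∈ U, deriv F (p 2) ≠ 0
  S_ne : ∀ p ∈ U, S (p 2) ≠ 0
  R_ne : ∀ p ∈ U, scaleR Λ F (p 0) (p 2) ≠ 0
  W_ne : ∀ p ∈ U, scaleW Λ A B C F (p 0) (p 1) (p 2) ≠ 0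

namespace Spacetime

variable (X : Spacetime)

/-- The coefficient `R e^ν̂` of `dx`. -/
def a (p : Pt) : ℝ :=
  scaleR X.Λ X.F (p 0) (p 2) * Real.exp (nuHat X.A X.B X.C (p 1) (p 2))

/-- The coefficient `(R_{,y} + R ν̂_{,y}) / (S F_{,y})` of `dy`. -/
def b (p : Pt) : ℝ :=
  scaleW X.Λ X.A X.B X.C X.F (p 0) (p 1) (p 2) / (X.S (p 2) * deriv X.F (p 2))

/-- The metric `ds² = -dt² + R² e^{2ν̂} dx² + (R_{,y} + R ν̂_{,y})² / (S² F_{,y}²) dy²`. -/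
def metric (p : Pt) : Matrix (Fin 3) (Fin 3) ℝ :=
  Matrix.diagonal ![-1, X.a p ^ 2, X.b p ^ 2]

/-- The triad: the null vectors `l = (∂_t - (R e^ν̂)⁻¹ ∂_x) / 2` (index `0`) and
`n = (∂_t + (R e^ν̂)⁻¹ ∂_x) / 2` (index `2`), and the spacelike vector
`m = S F_{,y} / (2 (R_{,y} + R ν̂_{,y})) ∂_y` (index `1`). Its only non-zero inner products are
`ds²(l, n) = -1/2` and `ds²(m, m) = 1/4`. -/
def frame : Fin 3 → Pt → Fin 3 → ℝ
  | 0 => fun p => ![1 / 2, -(1 / (2 * X.a p)), 0]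
  | 1 => fun p => ![0, 0, 1 / (2 * X.b p)]
  | 2 => fun p => ![1 / 2, 1 / (2 * X.a p), 0]

/-- The coframe dual to `frame`: `dt - R e^ν̂ dx`, `2 b dy`, `dt + R e^ν̂ dx`. -/
def coframe : Fin 3 → Pt → Fin 3 → ℝ
  | 0 => fun p => ![1, -X.a p, 0]
  | 1 => fun p => ![0, 0, 2 * X.b p]
  | 2 => fun p => ![1, X.a p, 0]

/-- The frame derivatives of a scalar: `D` (`c = 0`), `δ` (`c = 1`), `Δ` (`c = 2`), the
derivatives along `l`, `m`, `n`. -/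
def frameDeriv (c : Fin 3) (f : Pt → ℝ) (p : Pt) : ℝ := fderiv ℝ f p (X.frame c p)

/-- The connection coefficients `θᵃ(∇_{e_c} e_b)` in the triad `e₀ = l, e₁ = m, e₂ = n` with dual
coframe `θ`. -/
def conn (a b c : Fin 3) (p : Pt) : ℝ :=
  ∑ i, X.coframe a p i * ∑ j, X.frame c p j *
    (pd j (fun q => X.frame b q i) p
      + ∑ k, christoffel X.metric i j k p * X.frame b p k)

/-! The nine real spin coefficients of the 3D Newman-Penrose formalism, defined by
`D l = 2 ε l - 2 κ m`, `D n = -2 ε n + 2 π m`,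
`δ l = 2 α l - 2 σ m`, `δ n = -2 α n + 2 λ m`,
`Δ l = 2 γ l - 2 τ m`, `Δ n = -2 γ n + 2 ν m`. -/

def spinκ : Pt → ℝ := fun p => -(1 / 2) * X.conn 1 0 0 p
def spinσ : Pt → ℝ := fun p => -(1 / 2) * X.conn 1 0 1 p
def spinτ : Pt → ℝ := fun p => -(1 / 2) * X.conn 1 0 2 p
def spinε : Pt → ℝ := fun p => (1 / 2) * X.conn 0 0 0 p
def spinα : Pt → ℝ := fun p => (1 / 2) * X.conn 0 0 1 p
def spinγ : Pt → ℝ := fun p => (1 / 2) * X.conn 0 0 2 p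
def spinπ : Pt → ℝ := fun p => (1 / 2) * X.conn 1 2 0 p
def spinlam : Pt → ℝ := fun p => (1 / 2) * X.conn 1 2 1 p
def spinν : Pt → ℝ := fun p => (1 / 2) * X.conn 1 2 2 p

/-- `S(v, w)` for two vectors of the triad, `S` the trace-free Ricci tensor. -/
def tfRicciFrame (v w : Fin 3) (p : Pt) : ℝ :=
  X.frame v p ⬝ᵥ (traceFreeRicci X.metric p).mulVec (X.frame w p)

/-- The trace-free Ricci components `Ψ₀ = S(l,l)`, `Ψ₁ = S(l,m)`, `Ψ₂ = S(m,m)` (which equals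
`S(l,n)`), `Ψ₃ = S(m,n)`, `Ψ₄ = S(n,n)`. -/
def Ψ : Fin 5 → Pt → ℝ
  | 0 => X.tfRicciFrame 0 0
  | 1 => X.tfRicciFrame 0 1
  | 2 => X.tfRicciFrame 1 1
  | 3 => X.tfRicciFrame 1 2
  | 4 => X.tfRicciFrame 2 2

/-- The Cartan invariants of order `k`: the components of `∇ᵏ Riem` in the triad. -/
def cartan (k : ℕ) (J : Fin (4 + k) → Fin 3) (p : Pt) : ℝ :=
  ∑ I : Fin (4 + k) → Fin 3,
    curvatureDeriv X.metric k p I * ∏ i, X.frame (J i) p (I i)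

/-- The number `t_q` of functionally independent functions of the coordinates among the Cartan
invariants up to order `q`: the rank of their differentials. -/
def invariantCount (q : ℕ) (p : Pt) : ℕ :=
  Module.finrank ℝ (Submodule.span ℝ
    {φ : Pt →L[ℝ] ℝ | ∃ k ≤ q, ∃ J : Fin (4 + k) → Fin 3, φ = fderiv ℝ (X.cartan k J) p})

/-- The stopping criterion of the Cartan-Karlhede algorithm at the iteration `q ≥ 1`: neither the
number of functionally independent invariants nor the dimension of the isotropy group has changed
since the iteration before. -/
def StopsAt (q : ℕ) (p : Pt) : Prop :=
  1 ≤ q ∧ X.invariantCount q p = X.invariantCount (q - 1) p ∧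
    isotropyDim X.metric q p = isotropyDim X.metric (q - 1) p

/-- The twelve basic invariants: `Λ, Ψ₂` (order 0); `γ, σ - λ, δΨ₂, ΔΨ₂` (order 1);
`π, σ + λ, δ(σ - λ), δδΨ₂, ΔΔΨ₂, ΔδΨ₂` (order 2). -/
def basic : Fin 12 → Pt → ℝ :=
  ![fun _ => X.Λ,
    X.Ψ 2,
    X.spinγ,
    X.spinσ - X.spinlam,
    X.frameDeriv 1 (X.Ψ 2),
    X.frameDeriv 2 (X.Ψ 2),
    X.spinπ,
    X.spinσ + X.spinlam,
    X.frameDeriv 1 (X.spinσ - X.spinlam),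
    X.frameDeriv 1 (X.frameDeriv 1 (X.Ψ 2)),
    X.frameDeriv 2 (X.frameDeriv 2 (X.Ψ 2)),
    X.frameDeriv 2 (X.frameDeriv 1 (X.Ψ 2))]

end Spacetime

/-- How many of the twelve basic invariants have order at most `q`. -/
def numBasic : ℕ → ℕ
  | 0 => 2
  | 1 => 6
  | _ => 12

/-- The order of the `i`-th basic invariant. -/
def basicOrder (i : Fin 12) : ℕ := if i.val < 2 then 0 else if i.val < 6 then 1 else 2

/-- The (extended) Cartan invariants up to second order: all components of `∇ᵏ Riem`, `k ≤ 2`,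
in the triad; `Λ` and the components of the trace-free Ricci tensor; the spin coefficients; the
frame derivatives of the first-order ones, `γ` and `σ - λ`; the first and second frame derivatives
of `Ψ₂`. -/
inductive ExtInvariant where
  | curv (k : Fin 3) (J : Fin (4 + k.val) → Fin 3)
  | cosm
  | psi (i : Fin 5)
  | gamma
  | epsilon
  | sigmaSubLam
  | dPsi (c : Fin 3)
  | kappa
  | sigma
  | tau
  | alpha
  | pi
  | lam
  | nu
  | dGamma (c : Fin 3)
  | dSigmaSubLam (c : Fin 3)
  | ddPsi (c d : Fin 3)

namespace ExtInvariant

/-- The order (of covariant differentiation) at which an invariant appears. -/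
def order : ExtInvariant → ℕ
  | curv k _ => k.val
  | cosm => 0
  | psi _ => 0
  | gamma => 1
  | epsilon => 1
  | sigmaSubLam => 1
  | dPsi _ => 1
  | kappa => 2
  | sigma => 2
  | tau => 2
  | alpha => 2
  | pi => 2
  | lam => 2
  | nu => 2
  | dGamma _ => 2
  | dSigmaSubLam _ => 2
  | ddPsi _ _ => 2

/-- The value of an invariant in a given spacetime. -/
def value (X : Spacetime) : ExtInvariant → Pt → ℝ
  | curv k J => X.cartan k.val J
  | cosm => fun _ => X.Λ
  | psi i => X.Ψ i
  | gamma => X.spinγ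
  | epsilon => X.spinε
  | sigmaSubLam => X.spinσ - X.spinlam
  | dPsi c => X.frameDeriv c (X.Ψ 2)
  | kappa => X.spinκ
  | sigma => X.spinσ
  | tau => X.spinτ
  | alpha => X.spinα
  | pi => X.spinπ
  | lam => X.spinlam
  | nu => X.spinν
  | dGamma c => X.frameDeriv c X.spinγ
  | dSigmaSubLam c => X.frameDeriv c (X.spinσ - X.spinlam)
  | ddPsi c d => X.frameDeriv c (X.frameDeriv d (X.Ψ 2))

end ExtInvariant

/-- Indices of the components of the covariant derivatives of the curvature tensor. -/
abbrev CurvIndex := Σ k : ℕ, (Fin (4 + k) → Fin 3)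

end Szekeres3D

end

/-!
The proof works in the orthonormal frame `e₀ = ∂_t`, `e₁ = a⁻¹ ∂_x`, `e₂ = b⁻¹ ∂_y`, where `a` and
`b` are the coefficients of `dx` and `dy` in the metric; the null triad is a constant linear
combination of it. The connection of this frame has only four coefficients: the expansion rates
`h = a_{,t} / a` and `k = b_{,t} / b`, and the rotation coefficients `r = a_{,y} / (a b)` and
`s = b_{,x} / (a b)`.

The explicit form of `a` and `b` enters only through `a_{,tt} = Λ a`, `b_{,tt} = Λ b`, through the
vanishing of `(a_{,y} / b)_{,t}`, `(b_{,x} / a)_{,t}` and `(a_{,t} / a)_{,x}`, and through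
`h ≠ k`. The last fact holds on the whole domain: `k - h` is a non-zero multiple of the Wronskian
of `ch_Λ` and `sh_Λ`, because `F_{,y}` does not vanish (`expansion_ne`). It follows that the
curvature is `Λ (η η - η η) + ρ (P P - P P)`, where `P` is the projection orthogonal to the dust
velocity (`riemann_eq`), that `Ψ₂ = ρ / 12`, and that `e₀ h = Λ - h²`, `e₁ h = 0`,
`e₂ h = r (k - h)`, `e₀ k = Λ - k²`, `e₁ k = s (h - k)` and `e₀ ρ = -ρ (h + k)`.

*Polynomials.* By `orth_covDeriv`, frame components of a covariant derivative are frame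
derivatives of components, corrected by connection coefficients. The curvature is invariant under
rotations of the `e₁, e₂` plane, so `r` and `s` drop out of its first derivative
(`connCoeff_proj`), which is thus a polynomial in `Λ`, `ρ`, `h`, `k` and the derivatives of `ρ`.
The derivatives of these scalars are polynomials in the twelve basic invariants, with the help of
the commutators of the frame (`BasicPoly.orthDeriv`), and so are all the extended invariants
(`basicPoly_value`). No thirteen polynomials in twelve variables are algebraically independent, by
transcendence degree.

*Converse.* The curvature gives `Λ` and `ρ`. Its first derivative gives `ρ h`, `ρ k` and the
gradient of `ρ`; its second derivative gives the Hessian of `ρ`, `ρ e₂ k`, `ρ r (k - h)` and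
`ρ s (k - h)`. All divisions are by `ρ` and `k - h`, which do not vanish (`cartanRat_basic`).

*Isotropy.* Differentiating the invariance under a one-parameter group at the identity gives
linear equations for its generator. Invariance of the metric and the curvature leaves the
multiples of the rotation of the `e₁, e₂` plane; conversely, these rotations preserve the metric
and `P`. The first derivative of the curvature contains `ρ` times the expansion tensor
`diag (h, k)`, which no infinitesimal rotation preserves as `h ≠ k`. Hence the dimensions are
`1, 0, 0`. A count of three differentials is maximal in dimension three, which settles the
stopping order.
-/

noncomputable section

namespace Szekeres3D

/-! ### Calculus of coordinate partial derivatives -/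

section Calculus

variable {U : Set Pt} {f g : Pt → ℝ} {p : Pt}

lemma fderiv_apply_eq_sum_pd (f : Pt → ℝ) (p v : Pt) : fderiv ℝ f p v = ∑ i, v i * pd i f p := by
  conv_lhs => rw [pi_eq_sum_univ' v]
  simp [map_sum, pd]

lemma pd_congr_of_eqOn (hU : IsOpen U) (hp : p ∈ U) (h : ∀ q ∈ U, f q = g q) (i : Fin 3) :
    pd i f p = pd i g p := by
  have : f =ᶠ[nhds p] g := Filter.eventually_of_mem (hU.mem_nhds hp) h
  simp only [pd, this.fderiv_eq]

@[simp] lemma pd_const (i : Fin 3) (c : ℝ) (p : Pt) : pd i (fun _ => c) p = 0 := by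
  simp [pd]

lemma pd_add (i : Fin 3) (hf : DifferentiableAt ℝ f p) (hg : DifferentiableAt ℝ g p) :
    pd i (fun q => f q + g q) p = pd i f p + pd i g p := by
  simp [pd, fderiv_fun_add hf hg]

lemma pd_sub (i : Fin 3) (hf : DifferentiableAt ℝ f p) (hg : DifferentiableAt ℝ g p) :
    pd i (fun q => f q - g q) p = pd i f p - pd i g p := by
  simp [pd, fderiv_fun_sub hf hg]

lemma pd_neg (i : Fin 3) (f : Pt → ℝ) (p : Pt) : pd i (fun q => -f q) p = -pd i f p := by
  simp [pd, fderiv_fun_neg]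

lemma pd_mul (i : Fin 3) (hf : DifferentiableAt ℝ f p) (hg : DifferentiableAt ℝ g p) :
    pd i (fun q => f q * g q) p = pd i f p * g p + f p * pd i g p := by
  simp [pd, fderiv_fun_mul hf hg]; ring

lemma pd_const_mul (i : Fin 3) (c : ℝ) (hf : DifferentiableAt ℝ f p) :
    pd i (fun q => c * f q) p = c * pd i f p := by
  rw [pd_mul i (differentiableAt_const c) hf]; simp

lemma pd_div (i : Fin 3) (hf : DifferentiableAt ℝ f p) (hg : DifferentiableAt ℝ g p)
    (h0 : g p ≠ 0) :
    pd i (fun q => f q / g q) p = (pd i f p * g p - f p * pd i g p) / g p ^ 2 := by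
  have h1 : pd i (fun q => (f q / g q) * g q) p = pd i f p := by
    have hev : (fun q => (f q / g q) * g q) =ᶠ[nhds p] f := by
      filter_upwards [hg.continuousAt.eventually_ne h0] with q hq
      field_simp
    simp only [pd, hev.fderiv_eq]
  rw [pd_mul i (by simp only [div_eq_mul_inv]; exact hf.fun_mul (hg.inv h0)) hg] at h1
  rw [← h1]
  field_simp
  ring

/-- The partial derivative as the derivative of a function of one variable. -/
lemma hasDerivAt_comp_update (hf : DifferentiableAt ℝ f p) (i : Fin 3) :
    HasDerivAt (fun s => f (Function.update p i s)) (pd i f p) (p i) := by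
  have h1 := _root_.hasDerivAt_update p i (p i)
  have h2 : HasFDerivAt f (fderiv ℝ f p) (Function.update p i (p i)) := by
    rw [Function.update_eq_self]; exact hf.hasFDerivAt
  exact h2.comp_hasDerivAt (p i) h1

lemma pd_eq_of_hasDerivAt (hf : DifferentiableAt ℝ f p) (i : Fin 3) {v : ℝ}
    (h : HasDerivAt (fun s => f (Function.update p i s)) v (p i)) : pd i f p = v :=
  (hasDerivAt_comp_update hf i).unique h

lemma pd_eq_zero_of_update (hf : DifferentiableAt ℝ f p) (i : Fin 3)
    (h : ∀ s, f (Function.update p i s) = f p) : pd i f p = 0 := by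
  refine pd_eq_of_hasDerivAt hf i ?_
  simp only [h]; exact hasDerivAt_const _ _

lemma _root_.ContDiffOn.differentiableAt_of_isOpen (hf : ContDiffOn ℝ ∞ f U) (hU : IsOpen U)
    (hp : p ∈ U) : DifferentiableAt ℝ f p :=
  (hf.contDiffAt (hU.mem_nhds hp)).differentiableAt (by simp)

lemma contDiffOn_pd (hU : IsOpen U) (hf : ContDiffOn ℝ ∞ f U) (i : Fin 3) :
    ContDiffOn ℝ ∞ (pd i f) U := by
  have := hf.fderiv_of_isOpen hU (m := ∞) (by simp)
  exact this.clm_apply contDiffOn_const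

lemma pd_comm (hU : IsOpen U) (hf : ContDiffOn ℝ ∞ f U) (hp : p ∈ U) (i j : Fin 3) :
    pd i (pd j f) p = pd j (pd i f) p := by
  have hc := hf.contDiffAt (hU.mem_nhds hp)
  have hs : IsSymmSndFDerivAt ℝ f p := hc.isSymmSndFDerivAt
    (by simpa using (WithTop.coe_le_coe.2 le_top : ((2 : ℕ∞) : ℕ∞ω) ≤ ∞))
  have hd : DifferentiableAt ℝ (fderiv ℝ f) p :=
    ((hf.fderiv_of_isOpen hU (m := ∞) (by simp)).contDiffAt (hU.mem_nhds hp)).differentiableAt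
      (by simp)
  have key : ∀ i j : Fin 3, pd i (pd j f) p
      = fderiv ℝ (fderiv ℝ f) p (Pi.single i 1) (Pi.single j 1) := by
    intro i j
    have : pd j f = fun q => fderiv ℝ f q (Pi.single j 1) := rfl
    rw [this]
    simp only [pd]
    rw [fderiv_clm_apply hd (by fun_prop)]
    simp
  rw [key, key, hs.eq]

end Calculus

/-! ### The generalized hyperbolic functions -/

lemma hasDerivAt_chL (Λ t : ℝ) : HasDerivAt (chL Λ) (Λ * shL Λ t) t := by
  rcases lt_trichotomy Λ 0 with h | h | h
  · have e : chL Λ = fun t => Real.cos (Real.sqrt (-Λ) * t) := by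
      funext t; simp [chL, not_le.2 h]
    have hs : 0 < Real.sqrt (-Λ) := Real.sqrt_pos.2 (by linarith)
    have h2 : Real.sqrt (-Λ) * Real.sqrt (-Λ) = -Λ := Real.mul_self_sqrt (by linarith)
    rw [e]
    refine (((hasDerivAt_id' t).const_mul (Real.sqrt (-Λ))).cos).congr_deriv ?_
    simp only [shL, not_lt.2 h.le, h.ne, if_false]
    field_simp
    linear_combination (-Real.sin (Real.sqrt (-Λ) * t)) * h2
  · have e : chL Λ = fun t => 1 := by
      funext t; simp [chL, h]
    rw [e, h, zero_mul]; exact hasDerivAt_const _ _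
  · have e : chL Λ = fun t => Real.cosh (Real.sqrt Λ * t) := by
      funext t; simp [chL, h.le]
    have hs : 0 < Real.sqrt Λ := Real.sqrt_pos.2 h
    have h2 : Real.sqrt Λ * Real.sqrt Λ = Λ := Real.mul_self_sqrt h.le
    rw [e]
    refine (((hasDerivAt_id' t).const_mul (Real.sqrt Λ)).cosh).congr_deriv ?_
    simp only [shL, h, if_true]
    field_simp
    linear_combination (Real.sinh (Real.sqrt Λ * t)) * h2

lemma hasDerivAt_shL (Λ t : ℝ) : HasDerivAt (shL Λ) (chL Λ t) t := by
  rcases lt_trichotomy Λ 0 with h | h | h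
  · have e : shL Λ = fun t => Real.sin (Real.sqrt (-Λ) * t) / Real.sqrt (-Λ) := by
      funext t; simp [shL, not_lt.2 h.le, h.ne]
    have hs : 0 < Real.sqrt (-Λ) := Real.sqrt_pos.2 (by linarith)
    rw [e]
    refine (((hasDerivAt_id' t).const_mul (Real.sqrt (-Λ))).sin.div_const _).congr_deriv ?_
    simp only [chL, not_le.2 h, if_false]
    field_simp
  · have e : shL Λ = fun t => t := by
      funext t; simp [shL, h]
    rw [e, h]; have e2 : chL 0 t = 1 := by simp [chL]
    rw [e2]; exact hasDerivAt_id' t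
  · have e : shL Λ = fun t => Real.sinh (Real.sqrt Λ * t) / Real.sqrt Λ := by
      funext t; simp [shL, h]
    have hs : 0 < Real.sqrt Λ := Real.sqrt_pos.2 h
    rw [e]
    refine (((hasDerivAt_id' t).const_mul (Real.sqrt Λ)).sinh.div_const _).congr_deriv ?_
    simp only [chL, h.le, if_true]
    field_simp

lemma contDiff_chL_shL (Λ : ℝ) : ContDiff ℝ ∞ (chL Λ) ∧ ContDiff ℝ ∞ (shL Λ) := by
  have d1 : deriv (chL Λ) = fun t => Λ * shL Λ t := funext fun t => (hasDerivAt_chL Λ t).deriv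
  have d2 : deriv (shL Λ) = chL Λ := funext fun t => (hasDerivAt_shL Λ t).deriv
  have key : ∀ n : ℕ, ContDiff ℝ n (chL Λ) ∧ ContDiff ℝ n (shL Λ) := by
    intro n
    induction n with
    | zero =>
      exact ⟨contDiff_zero.2 (continuous_iff_continuousAt.2 fun t =>
          (hasDerivAt_chL Λ t).continuousAt), contDiff_zero.2 (continuous_iff_continuousAt.2
          fun t => (hasDerivAt_shL Λ t).continuousAt)⟩
    | succ n ih =>
      push_cast
      constructor
      · refine contDiff_succ_iff_deriv.2 ⟨fun t => (hasDerivAt_chL Λ t).differentiableAt,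
          by simp, ?_⟩
        rw [d1]; exact contDiff_const.mul ih.2
      · refine contDiff_succ_iff_deriv.2 ⟨fun t => (hasDerivAt_shL Λ t).differentiableAt,
          by simp, ?_⟩
        rw [d2]; exact ih.1
  exact ⟨contDiff_infty.2 fun n => (key n).1, contDiff_infty.2 fun n => (key n).2⟩

lemma chL_sq_sub (Λ t : ℝ) : chL Λ t * chL Λ t - Λ * shL Λ t * shL Λ t = 1 := by
  have hd : ∀ t, HasDerivAt (fun t => chL Λ t * chL Λ t - Λ * shL Λ t * shL Λ t) 0 t := by
    intro t
    have h1 := hasDerivAt_chL Λ t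
    have h2 := hasDerivAt_shL Λ t
    refine ((h1.mul h1).sub ((h2.const_mul Λ).mul h2)).congr_deriv ?_
    ring
  have := is_const_of_deriv_eq_zero (fun t => (hd t).differentiableAt) (fun t => (hd t).deriv) t 0
  rw [this]
  have e1 : chL Λ 0 = 1 := by simp [chL]
  have e2 : shL Λ 0 = 0 := by simp [shL]
  simp [e1, e2]

namespace Spacetime

variable (X : Spacetime)

/-! ### The metric coefficients of a Szekeres spacetime -/

/-- `R` as a function on the coordinate domain. -/
def Rf (p : Pt) : ℝ := scaleR X.Λ X.F (p 0) (p 2)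

/-- `ν̂` as a function on the coordinate domain. -/
def Nf (p : Pt) : ℝ := nuHat X.A X.B X.C (p 1) (p 2)

variable {X} {p : Pt}

lemma contDiffOn_comp_y {f : ℝ → ℝ} (h : ∀ p ∈ X.U, ContDiffAt ℝ ∞ f (p 2)) :
    ContDiffOn ℝ ∞ (fun p : Pt => f (p 2)) X.U := fun p hp =>
  ((h p hp).comp p ((contDiff_apply ℝ ℝ (2 : Fin 3)).contDiffAt)).contDiffWithinAt

lemma contDiffOn_Rf : ContDiffOn ℝ ∞ X.Rf X.U := by
  have h1 : ContDiff ℝ ∞ (fun p : Pt => chL X.Λ (p 0)) :=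
    (contDiff_chL_shL X.Λ).1.comp (contDiff_apply ℝ ℝ (0 : Fin 3))
  have h2 : ContDiff ℝ ∞ (fun p : Pt => shL X.Λ (p 0)) :=
    (contDiff_chL_shL X.Λ).2.comp (contDiff_apply ℝ ℝ (0 : Fin 3))
  exact h1.contDiffOn.add ((contDiffOn_comp_y X.smooth_F).mul h2.contDiffOn)

lemma contDiffOn_Nf : ContDiffOn ℝ ∞ X.Nf X.U := by
  have hx : ContDiff ℝ ∞ (fun p : Pt => p 1) := contDiff_apply ℝ ℝ (1 : Fin 3)
  have h : ContDiffOn ℝ ∞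
      (fun p : Pt => X.A (p 2) * p 1 ^ 2 + 2 * X.B (p 2) * p 1 + X.C (p 2)) X.U :=
    (((contDiffOn_comp_y X.smooth_A).mul (hx.contDiffOn.pow 2)).add
      ((contDiffOn_const.mul (contDiffOn_comp_y X.smooth_B)).mul hx.contDiffOn)).add
      (contDiffOn_comp_y X.smooth_C)
  exact (h.log fun p hp => (X.quad_pos p hp).ne').neg

lemma a_eq (p : Pt) : X.a p = X.Rf p * Real.exp (X.Nf p) := rfl

lemma contDiffOn_a : ContDiffOn ℝ ∞ X.a X.U := contDiffOn_Rf.mul contDiffOn_Nf.exp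

lemma deriv_comp_update {U : Set Pt} {f : Pt → ℝ} (hU : IsOpen U) (hf : ContDiffOn ℝ ∞ f U)
    (hp : p ∈ U) (i : Fin 3) :
    deriv (fun s => f (Function.update p i s)) (p i) = pd i f p :=
  (hasDerivAt_comp_update (hf.differentiableAt_of_isOpen hU hp) i).deriv

lemma deriv_scaleR (hp : p ∈ X.U) :
    deriv (fun z => scaleR X.Λ X.F (p 0) z) (p 2) = pd 2 X.Rf p := by
  rw [← deriv_comp_update X.isOpen_U contDiffOn_Rf hp 2]; simp [Rf]

lemma deriv_nuHat (hp : p ∈ X.U) :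
    deriv (fun z => nuHat X.A X.B X.C (p 1) z) (p 2) = pd 2 X.Nf p := by
  rw [← deriv_comp_update X.isOpen_U contDiffOn_Nf hp 2]; simp [Nf]

lemma deriv_F (hp : p ∈ X.U) : deriv X.F (p 2) = pd 2 (fun q => X.F (q 2)) p := by
  rw [← deriv_comp_update X.isOpen_U (contDiffOn_comp_y X.smooth_F) hp 2]; simp

/-- `S F_{,y}` as a function on the coordinate domain. -/
def SF (X : Spacetime) (p : Pt) : ℝ := X.S (p 2) * pd 2 (fun q => X.F (q 2)) p

lemma contDiffOn_SF : ContDiffOn ℝ ∞ X.SF X.U :=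
  (contDiffOn_comp_y X.smooth_S).mul
    (contDiffOn_pd X.isOpen_U (contDiffOn_comp_y X.smooth_F) 2)

lemma SF_ne (hp : p ∈ X.U) : X.SF p ≠ 0 := by
  rw [SF, ← deriv_F hp]; exact mul_ne_zero (X.S_ne p hp) (X.dF_ne p hp)

lemma b_eq (hp : p ∈ X.U) : X.b p = (pd 2 X.Rf p + X.Rf p * pd 2 X.Nf p) / X.SF p := by
  rw [b, scaleW, deriv_scaleR hp, deriv_nuHat hp, deriv_F hp]; rfl

lemma contDiffOn_b : ContDiffOn ℝ ∞ X.b X.U := by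
  have h : ContDiffOn ℝ ∞ (fun p => (pd 2 X.Rf p + X.Rf p * pd 2 X.Nf p) / X.SF p) X.U :=
    ((contDiffOn_pd X.isOpen_U contDiffOn_Rf 2).add
      (contDiffOn_Rf.mul (contDiffOn_pd X.isOpen_U contDiffOn_Nf 2))).div contDiffOn_SF
      fun p hp => SF_ne hp
  exact h.congr fun p hp => b_eq hp

lemma a_ne (hp : p ∈ X.U) : X.a p ≠ 0 := mul_ne_zero (X.R_ne p hp) (Real.exp_ne_zero _)

lemma b_ne (hp : p ∈ X.U) : X.b p ≠ 0 := by
  rw [b, deriv_F hp]; exact div_ne_zero (X.W_ne p hp) (SF_ne hp)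

/-- Smooth functions on the domain of the spacetime. -/
abbrev Smooth (X : Spacetime) (f : Pt → ℝ) : Prop := ContDiffOn ℝ ∞ f X.U

lemma Smooth.diff {f : Pt → ℝ} (hf : X.Smooth f) (hp : p ∈ X.U) : DifferentiableAt ℝ f p :=
  hf.differentiableAt_of_isOpen X.isOpen_U hp

lemma Smooth.pd {f : Pt → ℝ} (hf : X.Smooth f) (i : Fin 3) : X.Smooth (pd i f) :=
  contDiffOn_pd X.isOpen_U hf i

lemma pd_congr {f g : Pt → ℝ} (h : ∀ q ∈ X.U, f q = g q) (hp : p ∈ X.U) (i : Fin 3) :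
    pd i f p = pd i g p := pd_congr_of_eqOn X.isOpen_U hp h i

lemma pd_zero_Nf (hp : p ∈ X.U) : pd 0 X.Nf p = 0 :=
  pd_eq_zero_of_update (Smooth.diff contDiffOn_Nf hp) 0 fun s => by simp [Nf]

lemma pd_zero_pd_two_Nf (hp : p ∈ X.U) : pd 0 (pd 2 X.Nf) p = 0 := by
  rw [pd_comm X.isOpen_U contDiffOn_Nf hp 0 2, pd_congr (g := fun _ => 0)
    (fun q hq => pd_zero_Nf hq) hp]; simp

lemma pd_zero_SF (hp : p ∈ X.U) : pd 0 X.SF p = 0 := by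
  rw [pd_congr (g := fun q => X.S (q 2) * deriv X.F (q 2))
    (fun q hq => by rw [deriv_F hq, SF]) hp]
  refine pd_eq_zero_of_update ?_ 0 fun s => by simp
  exact (Smooth.diff contDiffOn_SF hp).congr_of_eventuallyEq
    (Filter.eventually_of_mem (X.isOpen_U.mem_nhds hp) fun q hq => by simp only [deriv_F hq, SF])

lemma pd_one_SF (hp : p ∈ X.U) : pd 1 X.SF p = 0 := by
  rw [pd_congr (g := fun q => X.S (q 2) * deriv X.F (q 2))
    (fun q hq => by rw [deriv_F hq, SF]) hp]
  refine pd_eq_zero_of_update ?_ 1 fun s => by simp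
  exact (Smooth.diff contDiffOn_SF hp).congr_of_eventuallyEq
    (Filter.eventually_of_mem (X.isOpen_U.mem_nhds hp) fun q hq => by simp only [deriv_F hq, SF])

/-- The time derivative of `R`. -/
lemma pd_zero_Rf (hp : p ∈ X.U) :
    pd 0 X.Rf p = X.Λ * shL X.Λ (p 0) + X.F (p 2) * chL X.Λ (p 0) := by
  refine pd_eq_of_hasDerivAt (Smooth.diff contDiffOn_Rf hp) 0 ?_
  simp only [Rf, scaleR, Function.update_self, ne_eq, Fin.reduceEq, not_false_eq_true,
    Function.update_of_ne]
  exact (hasDerivAt_chL _ _).add ((hasDerivAt_shL _ _).const_mul _)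

lemma pd_one_Rf (hp : p ∈ X.U) : pd 1 X.Rf p = 0 :=
  pd_eq_zero_of_update (Smooth.diff contDiffOn_Rf hp) 1 fun s => by simp [Rf]

lemma contDiffOn_Rf_t :
    X.Smooth fun q => X.Λ * shL X.Λ (q 0) + X.F (q 2) * chL X.Λ (q 0) :=
  (Smooth.pd contDiffOn_Rf 0).congr fun _ hq => (pd_zero_Rf hq).symm

lemma pd_zero_pd_zero_Rf (hp : p ∈ X.U) : pd 0 (pd 0 X.Rf) p = X.Λ * X.Rf p := by
  rw [pd_congr (fun q hq => pd_zero_Rf hq) hp]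
  refine pd_eq_of_hasDerivAt (Smooth.diff contDiffOn_Rf_t hp) 0 ?_
  simp only [Rf, scaleR, Function.update_self, ne_eq, Fin.reduceEq, not_false_eq_true,
    Function.update_of_ne]
  refine (((hasDerivAt_shL _ _).const_mul _).add ((hasDerivAt_chL _ _).const_mul _)).congr_deriv ?_
  ring

lemma pd_two_Rf (hp : p ∈ X.U) :
    pd 2 X.Rf p = deriv X.F (p 2) * shL X.Λ (p 0) := by
  refine pd_eq_of_hasDerivAt (Smooth.diff contDiffOn_Rf hp) 2 ?_
  have hF := ((X.smooth_F p hp).differentiableAt (by simp)).hasDerivAt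
  simp only [Rf, scaleR, Function.update_self, ne_eq, Fin.reduceEq, not_false_eq_true,
    Function.update_of_ne]
  exact (hF.mul_const _).const_add _

lemma pd_two_pd_zero_Rf (hp : p ∈ X.U) :
    pd 2 (pd 0 X.Rf) p = deriv X.F (p 2) * chL X.Λ (p 0) := by
  rw [pd_congr (fun q hq => pd_zero_Rf hq) hp]
  refine pd_eq_of_hasDerivAt (Smooth.diff contDiffOn_Rf_t hp) 2 ?_
  have hF := ((X.smooth_F p hp).differentiableAt (by simp)).hasDerivAt
  simp only [Function.update_self, ne_eq, Fin.reduceEq, not_false_eq_true,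
    Function.update_of_ne]
  exact (hF.mul_const _).const_add _

lemma contDiffOn_expNf : X.Smooth fun q => Real.exp (X.Nf q) := contDiffOn_Nf.exp

lemma pd_expNf (hp : p ∈ X.U) (i : Fin 3) :
    pd i (fun q => Real.exp (X.Nf q)) p = Real.exp (X.Nf p) * pd i X.Nf p := by
  simp only [pd, fderiv_exp (Smooth.diff contDiffOn_Nf hp)]
  simp

lemma pd_a (hp : p ∈ X.U) (i : Fin 3) :
    pd i X.a p = (pd i X.Rf p + X.Rf p * pd i X.Nf p) * Real.exp (X.Nf p) := by
  have : X.a = fun q => X.Rf q * Real.exp (X.Nf q) := rfl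
  rw [this, pd_mul i (Smooth.diff contDiffOn_Rf hp) (Smooth.diff contDiffOn_expNf hp),
    pd_expNf hp]
  ring

lemma pd_zero_a (hp : p ∈ X.U) : pd 0 X.a p = pd 0 X.Rf p * Real.exp (X.Nf p) := by
  rw [pd_a hp, pd_zero_Nf hp]; ring

/-- The acceleration equation for the first scale factor. -/
lemma pd_zero_pd_zero_a (hp : p ∈ X.U) : pd 0 (pd 0 X.a) p = X.Λ * X.a p := by
  rw [pd_congr (fun q hq => pd_zero_a hq) hp,
    pd_mul 0 (Smooth.diff (Smooth.pd contDiffOn_Rf 0) hp) (Smooth.diff contDiffOn_expNf hp),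
    pd_expNf hp, pd_zero_Nf hp, pd_zero_pd_zero_Rf hp, a_eq]
  ring

lemma pd_two_a_div_b (hp : p ∈ X.U) :
    pd 2 X.a p / X.b p = X.SF p * Real.exp (X.Nf p) := by
  have h1 := b_ne hp
  have h2 := b_eq hp
  have h3 := SF_ne hp
  rw [div_eq_iff h1, pd_a hp, h2]
  field_simp

lemma pd_b (hp : p ∈ X.U) (i : Fin 3) (hi : pd i X.SF p = 0) :
    pd i X.b p = (pd i (pd 2 X.Rf) p + pd i X.Rf p * pd 2 X.Nf p
      + X.Rf p * pd i (pd 2 X.Nf) p) / X.SF p := by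
  have h3 := SF_ne hp
  have hR := Smooth.diff contDiffOn_Rf hp
  have hR2 := Smooth.diff (Smooth.pd contDiffOn_Rf 2) hp
  have hN2 := Smooth.diff (Smooth.pd contDiffOn_Nf 2) hp
  rw [pd_congr (fun q hq => b_eq hq) hp,
    pd_div i (by exact hR2.fun_add (hR.fun_mul hN2)) (Smooth.diff contDiffOn_SF hp) h3, hi,
    pd_add i hR2 (hR.fun_mul hN2), pd_mul i hR hN2]
  field_simp
  ring

lemma pd_zero_b (hp : p ∈ X.U) :
    pd 0 X.b p = (pd 2 (pd 0 X.Rf) p + pd 0 X.Rf p * pd 2 X.Nf p) / X.SF p := by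
  rw [pd_b hp 0 (pd_zero_SF hp), pd_zero_pd_two_Nf hp, pd_comm X.isOpen_U contDiffOn_Rf hp 0 2]
  simp

lemma pd_one_b_div_a (hp : p ∈ X.U) :
    pd 1 X.b p / X.a p = pd 1 (pd 2 X.Nf) p / (X.SF p * Real.exp (X.Nf p)) := by
  have h3 := SF_ne hp
  have hR : X.Rf p ≠ 0 := X.R_ne p hp
  have h4 : pd 1 (pd 2 X.Rf) p = 0 := by
    rw [pd_comm X.isOpen_U contDiffOn_Rf hp, pd_congr (fun q hq => pd_one_Rf hq) hp, pd_const]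
  rw [pd_b hp 1 (pd_one_SF hp), h4, pd_one_Rf hp, a_eq]
  field_simp
  ring

/-- The acceleration equation for the second scale factor. -/
lemma pd_zero_pd_zero_b (hp : p ∈ X.U) : pd 0 (pd 0 X.b) p = X.Λ * X.b p := by
  have h3 := SF_ne hp
  have hRt := Smooth.pd (X := X) contDiffOn_Rf 0
  have hR2 := Smooth.diff (hRt.pd 2) hp
  have hN2 := Smooth.diff (Smooth.pd contDiffOn_Nf 2) hp
  have h5 : pd 2 (pd 0 (pd 0 X.Rf)) p = X.Λ * pd 2 X.Rf p := by
    rw [pd_congr (fun q hq => pd_zero_pd_zero_Rf hq) hp,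
      pd_const_mul 2 _ (Smooth.diff contDiffOn_Rf hp)]
  rw [pd_congr (fun q hq => pd_zero_b hq) hp,
    pd_div 0 (by exact hR2.fun_add ((hRt.diff hp).fun_mul hN2)) (Smooth.diff contDiffOn_SF hp) h3,
    pd_add 0 hR2 ((hRt.diff hp).fun_mul hN2), pd_mul 0 (hRt.diff hp) hN2, pd_zero_SF hp,
    pd_comm X.isOpen_U hRt hp 0 2, h5, pd_zero_pd_zero_Rf hp, pd_zero_pd_two_Nf hp, b_eq hp]
  field_simp
  ring

/-- The mixed component of the field equations in the `t, y` directions. -/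
lemma pd_zero_pd_two_a_div_b (hp : p ∈ X.U) : pd 0 (fun q => pd 2 X.a q / X.b q) p = 0 := by
  rw [pd_congr (fun q hq => pd_two_a_div_b hq) hp,
    pd_mul 0 (Smooth.diff contDiffOn_SF hp) (Smooth.diff contDiffOn_expNf hp), pd_expNf hp,
    pd_zero_Nf hp, pd_zero_SF hp]
  ring

/-- The mixed component of the field equations in the `t, x` directions. -/
lemma pd_zero_pd_one_b_div_a (hp : p ∈ X.U) : pd 0 (fun q => pd 1 X.b q / X.a q) p = 0 := by
  have h3 := mul_ne_zero (SF_ne hp) (Real.exp_ne_zero (X.Nf p))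
  have hN2 := Smooth.pd (X := X) contDiffOn_Nf 2
  have h1 := Smooth.diff contDiffOn_SF hp
  have h2 := Smooth.diff contDiffOn_expNf hp
  have h6 : pd 0 (pd 1 (pd 2 X.Nf)) p = 0 := by
    rw [pd_comm X.isOpen_U hN2 hp, pd_congr (fun q hq => pd_zero_pd_two_Nf hq) hp, pd_const]
  rw [pd_congr (fun q hq => pd_one_b_div_a hq) hp,
    pd_div 0 ((hN2.pd 1).diff hp) (by exact h1.fun_mul h2) h3, pd_mul 0 h1 h2, pd_expNf hp,
    pd_zero_Nf hp, pd_zero_SF hp, h6]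
  simp

/-- The first expansion rate `R_{,t} / R` does not depend on `x`. -/
lemma pd_one_expansion (hp : p ∈ X.U) : pd 1 (fun q => pd 0 X.a q / X.a q) p = 0 := by
  have hR : X.Rf p ≠ 0 := X.R_ne p hp
  have h1 := Smooth.diff contDiffOn_Rf hp
  have h2 := Smooth.diff (Smooth.pd contDiffOn_Rf 0) hp
  rw [pd_congr (g := fun q => pd 0 X.Rf q / X.Rf q) (fun q hq => ?_) hp, pd_div 1 h2 h1 hR,
    pd_one_Rf hp, pd_comm X.isOpen_U contDiffOn_Rf hp, pd_congr (fun q hq => pd_one_Rf hq) hp,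
    pd_const]
  · simp
  · have hR : X.Rf q ≠ 0 := X.R_ne q hq
    simp only [pd_zero_a hq, a_eq]
    field_simp

/-- The two expansion rates are different: their difference is, up to a non-vanishing factor, the
Wronskian of `ch_Λ` and `sh_Λ` times `F_{,y}`. -/
lemma expansion_ne (hp : p ∈ X.U) : pd 0 X.a p / X.a p ≠ pd 0 X.b p / X.b p := by
  have h3 := SF_ne hp
  intro h
  rw [div_eq_div_iff (a_ne hp) (b_ne hp), pd_zero_b hp, b_eq hp, pd_zero_a hp, a_eq,
    pd_two_pd_zero_Rf hp, pd_two_Rf hp, pd_zero_Rf hp, Rf, scaleR] at h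
  have he := Real.exp_ne_zero (X.Nf p)
  field_simp at h
  have hw := chL_sq_sub X.Λ (p 0)
  apply X.dF_ne p hp
  linear_combination (-1) * h - deriv X.F (p 2) * hw

end Spacetime

namespace Spacetime

variable (X : Spacetime)

/-! ### Expansion rates, rotation rates and the density -/

/-- The expansion rate `h = a_{,t} / a` of the dust in the `x` direction. -/
def expX (p : Pt) : ℝ := pd 0 X.a p / X.a p

/-- The expansion rate `k = b_{,t} / b` of the dust in the `y` direction. -/
def expY (p : Pt) : ℝ := pd 0 X.b p / X.b p

/-- The rotation coefficient `r = a_{,y} / (a b)` of the orthonormal frame. -/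
def rotX (p : Pt) : ℝ := pd 2 X.a p / X.b p / X.a p

/-- The rotation coefficient `s = b_{,x} / (a b)` of the orthonormal frame. -/
def rotY (p : Pt) : ℝ := pd 1 X.b p / X.a p / X.b p

/-- The logarithmic derivative `a_{,x} / a`. -/
def logX (p : Pt) : ℝ := pd 1 X.a p / X.a p

/-- The logarithmic derivative `b_{,y} / b`. -/
def logY (p : Pt) : ℝ := pd 2 X.b p / X.b p

/-- The density `ρ` of the dust, normalized to be the sectional curvature of the `x, y` plane minus
`Λ`. -/
def density (p : Pt) : ℝ :=
  X.expX p * X.expY p - X.Λ - X.rotX p ^ 2 - X.rotY p ^ 2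
    - pd 1 X.rotY p / X.a p - pd 2 X.rotX p / X.b p

variable {X} {p : Pt}

lemma smooth_a : X.Smooth X.a := contDiffOn_a
lemma smooth_b : X.Smooth X.b := contDiffOn_b

lemma smooth_expX : X.Smooth X.expX := (smooth_a.pd 0).div smooth_a fun _ => a_ne
lemma smooth_expY : X.Smooth X.expY := (smooth_b.pd 0).div smooth_b fun _ => b_ne

lemma smooth_rotX : X.Smooth X.rotX :=
  ((smooth_a.pd 2).div smooth_b fun _ => b_ne).div smooth_a fun _ => a_ne
lemma smooth_rotY : X.Smooth X.rotY :=
  ((smooth_b.pd 1).div smooth_a fun _ => a_ne).div smooth_b fun _ => b_ne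

lemma smooth_density : X.Smooth X.density :=
  (((((smooth_expX.mul smooth_expY).sub contDiffOn_const).sub (smooth_rotX.pow 2)).sub
    (smooth_rotY.pow 2)).sub ((smooth_rotY.pd 1).div smooth_a fun _ => a_ne)).sub
    ((smooth_rotX.pd 2).div smooth_b fun _ => b_ne)

lemma pd0_a (hp : p ∈ X.U) : pd 0 X.a p = X.a p * X.expX p := by
  have := a_ne hp; rw [expX]; field_simp
lemma pd1_a (hp : p ∈ X.U) : pd 1 X.a p = X.a p * X.logX p := by
  have := a_ne hp; rw [logX]; field_simp
lemma pd2_a (hp : p ∈ X.U) : pd 2 X.a p = X.a p * X.b p * X.rotX p := by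
  have := a_ne hp; have := b_ne hp; rw [rotX]; field_simp
lemma pd0_b (hp : p ∈ X.U) : pd 0 X.b p = X.b p * X.expY p := by
  have := b_ne hp; rw [expY]; field_simp
lemma pd1_b (hp : p ∈ X.U) : pd 1 X.b p = X.a p * X.b p * X.rotY p := by
  have := a_ne hp; have := b_ne hp; rw [rotY]; field_simp
lemma pd2_b (hp : p ∈ X.U) : pd 2 X.b p = X.b p * X.logY p := by
  have := b_ne hp; rw [logY]; field_simp

lemma pd0_expX (hp : p ∈ X.U) : pd 0 X.expX p = X.Λ - X.expX p ^ 2 := by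
  have h := a_ne hp
  have := pd_div 0 ((smooth_a.pd 0).diff hp) (smooth_a.diff hp) h
  change pd 0 X.expX p = _ at this
  rw [this, pd_zero_pd_zero_a hp, pd0_a hp]; field_simp

lemma pd0_expY (hp : p ∈ X.U) : pd 0 X.expY p = X.Λ - X.expY p ^ 2 := by
  have h := b_ne hp
  have := pd_div 0 ((smooth_b.pd 0).diff hp) (smooth_b.diff hp) h
  change pd 0 X.expY p = _ at this
  rw [this, pd_zero_pd_zero_b hp, pd0_b hp]; field_simp

lemma pd1_expX (hp : p ∈ X.U) : pd 1 X.expX p = 0 := pd_one_expansion hp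

/-- Mixed derivatives of the logarithm of a scale factor commute. -/
lemma pd_logDeriv_comm {f : Pt → ℝ} (hf : X.Smooth f) (hp : p ∈ X.U) (h0 : f p ≠ 0)
    (i j : Fin 3) :
    pd i (fun q => pd j f q / f q) p = pd j (fun q => pd i f q / f q) p := by
  rw [pd_div i ((hf.pd j).diff hp) (hf.diff hp) h0, pd_div j ((hf.pd i).diff hp) (hf.diff hp) h0,
    pd_comm X.isOpen_U hf hp i j]
  ring

lemma pd0_rotX (hp : p ∈ X.U) : pd 0 X.rotX p = -X.expX p * X.rotX p := by
  have h := a_ne hp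
  have := pd_div 0 (((smooth_a.pd 2).div smooth_b fun _ => b_ne).differentiableAt_of_isOpen
    X.isOpen_U hp) (smooth_a.diff hp) h
  change pd 0 X.rotX p = _ at this
  have h2 : pd 0 (pd 2 X.a / X.b) p = 0 := pd_zero_pd_two_a_div_b hp
  rw [this, h2, pd0_a hp, rotX]; field_simp; simp; ring

lemma pd0_rotY (hp : p ∈ X.U) : pd 0 X.rotY p = -X.expY p * X.rotY p := by
  have h := b_ne hp
  have := pd_div 0 (((smooth_b.pd 1).div smooth_a fun _ => a_ne).differentiableAt_of_isOpen
    X.isOpen_U hp) (smooth_b.diff hp) h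
  change pd 0 X.rotY p = _ at this
  have h2 : pd 0 (pd 1 X.b / X.a) p = 0 := pd_zero_pd_one_b_div_a hp
  rw [this, h2, pd0_b hp, rotY]; field_simp; simp; ring

lemma pd2_expX (hp : p ∈ X.U) :
    pd 2 X.expX p = X.b p * X.rotX p * (X.expY p - X.expX p) := by
  have e : pd 2 X.expX p = pd 0 (fun q => pd 2 X.a q / X.a q) p :=
    pd_logDeriv_comm smooth_a hp (a_ne hp) 2 0
  rw [e, pd_congr (g := fun q => X.b q * X.rotX q) (fun q hq => ?_) hp,
    pd_mul 0 (smooth_b.diff hp) (smooth_rotX.diff hp), pd0_b hp, pd0_rotX hp]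
  · ring
  · have := a_ne hq
    rw [pd2_a hq]; field_simp

lemma pd1_expY (hp : p ∈ X.U) :
    pd 1 X.expY p = X.a p * X.rotY p * (X.expX p - X.expY p) := by
  have e : pd 1 X.expY p = pd 0 (fun q => pd 1 X.b q / X.b q) p :=
    pd_logDeriv_comm smooth_b hp (b_ne hp) 1 0
  rw [e, pd_congr (g := fun q => X.a q * X.rotY q) (fun q hq => ?_) hp,
    pd_mul 0 (smooth_a.diff hp) (smooth_rotY.diff hp), pd0_a hp, pd0_rotY hp]
  · ring
  · have := b_ne hq
    rw [pd1_b hq]; field_simp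

lemma pd0_logX (hp : p ∈ X.U) : pd 0 X.logX p = 0 :=
  (pd_logDeriv_comm smooth_a hp (a_ne hp) 0 1).trans (pd_one_expansion hp)

lemma pd2_logX (hp : p ∈ X.U) :
    pd 2 X.logX p = X.a p * X.b p * X.rotX p * X.rotY p + X.b p * pd 1 X.rotX p := by
  have e : pd 2 X.logX p = pd 1 (fun q => pd 2 X.a q / X.a q) p :=
    pd_logDeriv_comm smooth_a hp (a_ne hp) 2 1
  rw [e, pd_congr (g := fun q => X.b q * X.rotX q) (fun q hq => ?_) hp,
    pd_mul 1 (smooth_b.diff hp) (smooth_rotX.diff hp), pd1_b hp]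
  · ring
  · have := a_ne hq
    rw [pd2_a hq]; field_simp

lemma pd0_logY (hp : p ∈ X.U) : pd 0 X.logY p = pd 2 X.expY p :=
  pd_logDeriv_comm smooth_b hp (b_ne hp) 0 2

lemma pd1_logY (hp : p ∈ X.U) :
    pd 1 X.logY p = X.a p * X.b p * X.rotX p * X.rotY p + X.a p * pd 2 X.rotY p := by
  have e : pd 1 X.logY p = pd 2 (fun q => pd 1 X.b q / X.b q) p :=
    pd_logDeriv_comm smooth_b hp (b_ne hp) 1 2
  rw [e, pd_congr (g := fun q => X.a q * X.rotY q) (fun q hq => ?_) hp,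
    pd_mul 2 (smooth_a.diff hp) (smooth_rotY.diff hp), pd2_a hp]
  · have := b_ne hq
    rw [pd1_b hq]; field_simp

lemma expY_ne_expX (hp : p ∈ X.U) : X.expY p - X.expX p ≠ 0 :=
  sub_ne_zero.2 (expansion_ne hp).symm

/-- Conservation of the dust: the density decays at the rate of the volume expansion. -/
lemma pd0_density (hp : p ∈ X.U) :
    pd 0 X.density p = -X.density p * (X.expX p + X.expY p) := by
  have ha := a_ne hp
  have hb := b_ne hp
  have dh := smooth_expX.diff hp
  have dk := smooth_expY.diff hp
  have dp := smooth_rotX.diff hp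
  have dq := smooth_rotY.diff hp
  have da := smooth_a.diff hp
  have db := smooth_b.diff hp
  have dq1 := (smooth_rotY.pd 1).diff hp
  have dp2 := (smooth_rotX.pd 2).diff hp
  have s1 : X.Smooth fun q => pd 1 X.rotY q / X.a q := (smooth_rotY.pd 1).div smooth_a fun _ => a_ne
  have s2 : X.Smooth fun q => pd 2 X.rotX q / X.b q := (smooth_rotX.pd 2).div smooth_b fun _ => b_ne
  have e : pd 0 X.density p = pd 0 (fun q => X.expX q * X.expY q - X.Λ - X.rotX q * X.rotX q
      - X.rotY q * X.rotY q - pd 1 X.rotY q / X.a q - pd 2 X.rotX q / X.b q) p :=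
    pd_congr (fun q _ => by rw [density]; ring) hp 0
  have c1 : pd 0 (pd 1 X.rotY) p = -pd 1 X.expY p * X.rotY p - X.expY p * pd 1 X.rotY p := by
    rw [pd_comm X.isOpen_U smooth_rotY hp, pd_congr (fun q hq => pd0_rotY hq) hp,
      pd_mul 1 (by exact dk.fun_neg) dq, pd_neg]
    ring
  have c2 : pd 0 (pd 2 X.rotX) p = -pd 2 X.expX p * X.rotX p - X.expX p * pd 2 X.rotX p := by
    rw [pd_comm X.isOpen_U smooth_rotX hp, pd_congr (fun q hq => pd0_rotX hq) hp,
      pd_mul 2 (by exact dh.fun_neg) dp, pd_neg]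
    ring
  have t1 := dh.fun_mul dk
  have t2 := t1.fun_sub (differentiableAt_const X.Λ)
  have t3 := t2.fun_sub (dp.fun_mul dp)
  have t4 := t3.fun_sub (dq.fun_mul dq)
  have t5 := t4.fun_sub (s1.diff hp)
  rw [e, pd_sub 0 t5 (s2.diff hp), pd_sub 0 t4 (s1.diff hp), pd_sub 0 t3 (dq.fun_mul dq),
    pd_sub 0 t2 (dp.fun_mul dp), pd_sub 0 t1 (differentiableAt_const X.Λ), pd_mul 0 dh dk,
    pd_mul 0 dp dp, pd_mul 0 dq dq, pd_div 0 dq1 da ha, pd_div 0 dp2 db hb, c1, c2,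
    pd0_expX hp, pd0_expY hp, pd0_rotX hp, pd0_rotY hp, pd0_a hp, pd0_b hp, pd1_expY hp,
    pd2_expX hp, density]
  simp only [pd_const]
  field_simp
  ring

/-! ### Christoffel symbols and curvature -/

/-- The scale `(1, a, b)` of the coordinate vector fields. -/
def scale (X : Spacetime) (i : Fin 3) (p : Pt) : ℝ := ![1, X.a p, X.b p] i

lemma scale_ne (hp : p ∈ X.U) (i : Fin 3) : X.scale i p ≠ 0 := by
  fin_cases i <;> simp [scale, a_ne hp, b_ne hp]

lemma smooth_scale (i : Fin 3) : X.Smooth (X.scale i) := by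
  fin_cases i
  · exact contDiffOn_const
  · exact smooth_a
  · exact smooth_b

lemma metric_inv (hp : p ∈ X.U) :
    (X.metric p)⁻¹ = Matrix.diagonal ![-1, (X.a p ^ 2)⁻¹, (X.b p ^ 2)⁻¹] := by
  apply Matrix.inv_eq_left_inv
  rw [metric, Matrix.diagonal_mul_diagonal, ← Matrix.diagonal_one]
  congr 1
  have := a_ne hp
  have := b_ne hp
  funext i
  fin_cases i <;> simp <;> field_simp

lemma pd_metric (hp : p ∈ X.U) (c i j : Fin 3) :
    pd c (fun q => X.metric q i j) p
      = Matrix.diagonal ![0, 2 * X.a p * pd c X.a p, 2 * X.b p * pd c X.b p] i j := by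
  have da := smooth_a.diff hp
  have db := smooth_b.diff hp
  have e1 : pd c (fun q => X.a q ^ 2) p = 2 * X.a p * pd c X.a p := by
    simp only [pow_two]; rw [pd_mul c da da]; ring
  have e2 : pd c (fun q => X.b q ^ 2) p = 2 * X.b p * pd c X.b p := by
    simp only [pow_two]; rw [pd_mul c db db]; ring
  fin_cases i <;> fin_cases j <;> simp [metric, e1, e2]

/-- The Christoffel symbols `Γᵈ_cb` in terms of the expansion and rotation rates. -/
def chr (X : Spacetime) (d c b : Fin 3) : Pt → ℝ :=
  ![![![fun _ => 0, fun _ => 0, fun _ => 0],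
      ![fun _ => 0, fun q => X.a q * X.a q * X.expX q, fun _ => 0],
      ![fun _ => 0, fun _ => 0, fun q => X.b q * X.b q * X.expY q]],
    ![![fun _ => 0, X.expX, fun _ => 0],
      ![X.expX, X.logX, fun q => X.b q * X.rotX q],
      ![fun _ => 0, fun q => X.b q * X.rotX q, fun q => -(X.b q * X.b q * X.rotY q) / X.a q]],
    ![![fun _ => 0, fun _ => 0, X.expY],
      ![fun _ => 0, fun q => -(X.a q * X.a q * X.rotX q) / X.b q, fun q => X.a q * X.rotY q],
      ![X.expY, fun q => X.a q * X.rotY q, X.logY]]] d c b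

lemma christoffel_eq (hp : p ∈ X.U) (d c b : Fin 3) :
    christoffel X.metric d c b p = X.chr d c b p := by
  have ha := a_ne hp
  have hb := b_ne hp
  unfold christoffel
  rw [metric_inv hp]
  simp only [pd_metric hp, Fin.sum_univ_three]
  fin_cases d <;> fin_cases c <;> fin_cases b <;>
    simp [chr, pd0_a hp, pd1_a hp, pd2_a hp, pd0_b hp, pd1_b hp, pd2_b hp] <;>
    field_simp

/-- The coordinate derivatives `∂ₑ Γᵈ_cb`. -/
lemma pd_chr (hp : p ∈ X.U) (e d c b : Fin 3) :
    pd e (X.chr d c b) p =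
  ![![![0, 0, 0],
      ![0, 2 * X.a p * pd e X.a p * X.expX p + X.a p ^ 2 * pd e X.expX p, 0],
      ![0, 0, 2 * X.b p * pd e X.b p * X.expY p + X.b p ^ 2 * pd e X.expY p]],
    ![![0, pd e X.expX p, 0],
      ![pd e X.expX p, pd e X.logX p, pd e X.b p * X.rotX p + X.b p * pd e X.rotX p],
      ![0, pd e X.b p * X.rotX p + X.b p * pd e X.rotX p,
        -(2 * X.b p * pd e X.b p * X.rotY p + X.b p ^ 2 * pd e X.rotY p) / X.a p
          + X.b p ^ 2 * X.rotY p * pd e X.a p / X.a p ^ 2]],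
    ![![0, 0, pd e X.expY p],
      ![0, -(2 * X.a p * pd e X.a p * X.rotX p + X.a p ^ 2 * pd e X.rotX p) / X.b p
          + X.a p ^ 2 * X.rotX p * pd e X.b p / X.b p ^ 2,
        pd e X.a p * X.rotY p + X.a p * pd e X.rotY p],
      ![pd e X.expY p, pd e X.a p * X.rotY p + X.a p * pd e X.rotY p, pd e X.logY p]]] d c b := by
  have ha := a_ne hp
  have hb := b_ne hp
  have dh := smooth_expX.diff hp
  have dk := smooth_expY.diff hp
  have dp := smooth_rotX.diff hp
  have dq := smooth_rotY.diff hp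
  have da := smooth_a.diff hp
  have db := smooth_b.diff hp
  have f1 : pd e (fun q => X.a q * X.a q * X.expX q) p
      = 2 * X.a p * pd e X.a p * X.expX p + X.a p ^ 2 * pd e X.expX p := by
    rw [pd_mul e (da.fun_mul da) dh, pd_mul e da da]; ring
  have f2 : pd e (fun q => X.b q * X.b q * X.expY q) p
      = 2 * X.b p * pd e X.b p * X.expY p + X.b p ^ 2 * pd e X.expY p := by
    rw [pd_mul e (db.fun_mul db) dk, pd_mul e db db]; ring
  have f3 : pd e (fun q => X.b q * X.rotX q) p
      = pd e X.b p * X.rotX p + X.b p * pd e X.rotX p := pd_mul e db dp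
  have f4 : pd e (fun q => X.a q * X.rotY q) p
      = pd e X.a p * X.rotY p + X.a p * pd e X.rotY p := pd_mul e da dq
  have f5 : pd e (fun q => -(X.b q * X.b q * X.rotY q) / X.a q) p
      = -(2 * X.b p * pd e X.b p * X.rotY p + X.b p ^ 2 * pd e X.rotY p) / X.a p
          + X.b p ^ 2 * X.rotY p * pd e X.a p / X.a p ^ 2 := by
    rw [pd_div e (by exact ((db.fun_mul db).fun_mul dq).fun_neg) da ha, pd_neg,
      pd_mul e (db.fun_mul db) dq, pd_mul e db db]
    field_simp
    ring
  have f6 : pd e (fun q => -(X.a q * X.a q * X.rotX q) / X.b q) p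
      = -(2 * X.a p * pd e X.a p * X.rotX p + X.a p ^ 2 * pd e X.rotX p) / X.b p
          + X.a p ^ 2 * X.rotX p * pd e X.b p / X.b p ^ 2 := by
    rw [pd_div e (by exact ((da.fun_mul da).fun_mul dp).fun_neg) db hb, pd_neg,
      pd_mul e (da.fun_mul da) dp, pd_mul e da da]
    field_simp
    ring
  fin_cases d <;> fin_cases c <;> fin_cases b <;>
    first
    | exact pd_const _ _ _ | exact f1 | exact f2 | exact f3 | exact f4 | exact f5 | exact f6 | rfl

end Spacetime

/-! ### The curvature tensor -/

/-- The Minkowski metric `diag (-1, 1, 1)`. -/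
def eta (i j : Fin 3) : ℝ := if i = j then (if i = 0 then -1 else 1) else 0

/-- The projection `diag (0, 1, 1)` onto the space orthogonal to the dust velocity. -/
def proj (i j : Fin 3) : ℝ := if i = j then (if i = 0 then 0 else 1) else 0

/-- The components in the orthonormal frame of a curvature tensor of dust type: constant curvature
`Λ`, plus the curvature `ρ` in the plane orthogonal to the velocity. -/
def dustRiem (Λ ρ : ℝ) (I : Fin 4 → Fin 3) : ℝ :=
  Λ * (eta (I 0) (I 2) * eta (I 1) (I 3) - eta (I 0) (I 3) * eta (I 1) (I 2))
    + ρ * (proj (I 0) (I 2) * proj (I 1) (I 3) - proj (I 0) (I 3) * proj (I 1) (I 2))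

/-- The connection coefficients of the orthonormal frame: the component along `e_d` of the
covariant derivative of `e_b` in the direction `e_c`, in terms of the expansion rates `h`, `k` and
the rotation coefficients `r`, `s`. -/
def connCoeff (h k r s : ℝ) (d c b : Fin 3) : ℝ :=
  ![![![0, 0, 0], ![0, h, 0], ![0, 0, k]],
    ![![0, 0, 0], ![h, 0, r], ![0, 0, -s]],
    ![![0, 0, 0], ![0, -r, 0], ![k, s, 0]]] d c b

namespace Spacetime

variable {X : Spacetime} {p : Pt}

lemma pd_christoffel (hp : p ∈ X.U) (e d c b : Fin 3) :
    pd e (christoffel X.metric d c b) p = pd e (X.chr d c b) p :=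
  pd_congr (fun _ hq => christoffel_eq hq d c b) hp e

lemma riemannUp_antisymm (g : Pt → Matrix (Fin 3) (Fin 3) ℝ) (a b c d : Fin 3) (p : Pt) :
    riemannUp g a b d c p = -riemannUp g a b c d p := by
  simp only [riemannUp, Fin.sum_univ_three]; ring

lemma riemannUp_eq_of_lt (hp : p ∈ X.U) (a b c d : Fin 3) (hcd : c < d) :
    riemannUp X.metric a b c d p = eta a a * dustRiem X.Λ (X.density p) ![a, b, c, d]
      * (X.scale b p * X.scale c p * X.scale d p) / X.scale a p := by
  have ha := a_ne hp
  have hb := b_ne hp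
  simp only [riemannUp, pd_christoffel hp, christoffel_eq hp, pd_chr hp, Fin.sum_univ_three]
  fin_cases c <;> fin_cases d <;> (first | (exfalso; revert hcd; decide) | skip) <;>
  fin_cases a <;> fin_cases b <;>
    simp [chr, dustRiem, eta, proj, scale, density, pd0_a hp, pd1_a hp, pd2_a hp, pd0_b hp,
      pd1_b hp, pd2_b hp, pd0_expX hp, pd1_expX hp, pd2_expX hp, pd0_expY hp, pd1_expY hp,
      pd0_rotX hp, pd0_rotY hp, pd0_logX hp, pd2_logX hp, pd0_logY hp, pd1_logY hp] <;>
    field_simp <;> ring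

lemma riemannUp_eq (hp : p ∈ X.U) (a b c d : Fin 3) :
    riemannUp X.metric a b c d p = eta a a * dustRiem X.Λ (X.density p) ![a, b, c, d]
      * (X.scale b p * X.scale c p * X.scale d p) / X.scale a p := by
  rcases lt_trichotomy c d with h | h | h
  · exact riemannUp_eq_of_lt hp a b c d h
  · have h0 := riemannUp_antisymm X.metric a b c d p
    subst h
    have h1 : riemannUp X.metric a b c c p = 0 := by linarith
    rw [h1]
    simp [dustRiem]
  · rw [riemannUp_antisymm, riemannUp_eq_of_lt hp a b d c h]
    simp [dustRiem]
    ring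

lemma metric_apply (p : Pt) (i j : Fin 3) :
    X.metric p i j = eta i j * (X.scale i p * X.scale j p) := by
  fin_cases i <;> fin_cases j <;> simp [metric, eta, scale, pow_two]

/-- The curvature is that of a space of constant curvature `Λ`, plus `ρ` in the plane orthogonal to
the dust velocity. -/
lemma riemann_eq (hp : p ∈ X.U) (I : Fin 4 → Fin 3) :
    riemann X.metric p I = dustRiem X.Λ (X.density p) I * ∏ i, X.scale (I i) p := by
  have h0 := scale_ne hp (I 0)
  rw [riemann, Finset.sum_eq_single (I 0)]
  · rw [metric_apply, riemannUp_eq hp, Fin.prod_univ_four]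
    have e : eta (I 0) (I 0) * eta (I 0) (I 0) = 1 := by unfold eta; split_ifs <;> simp_all
    have e2 : dustRiem X.Λ (X.density p) ![I 0, I 1, I 2, I 3]
      = dustRiem X.Λ (X.density p) I := rfl
    rw [e2]
    field_simp
    linear_combination (dustRiem X.Λ (X.density p) I * X.scale (I 1) p * X.scale (I 2) p
      * X.scale (I 3) p) * e
  · intro e _ he
    rw [metric_apply, eta, if_neg he.symm]; ring
  · simp

lemma ricci_eq (hp : p ∈ X.U) (b d : Fin 3) :
    ricci X.metric b d p
      = (2 * X.Λ * eta b d + X.density p * proj b d) * (X.scale b p * X.scale d p) := by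
  have h1 := scale_ne hp 0
  have h2 := scale_ne hp 1
  have h3 := scale_ne hp 2
  simp only [ricci, riemannUp_eq hp, Fin.sum_univ_three]
  fin_cases b <;> fin_cases d <;> simp [dustRiem, eta, proj] <;> field_simp <;> ring

lemma scalarCurvature_eq (hp : p ∈ X.U) :
    scalarCurvature X.metric p = 6 * X.Λ + 2 * X.density p := by
  have ha := a_ne hp
  have hb := b_ne hp
  simp only [scalarCurvature, metric_inv hp, ricci_eq hp, Fin.sum_univ_three]
  simp [eta, proj, scale]
  field_simp
  ring

lemma traceFreeRicci_eq (hp : p ∈ X.U) :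
    traceFreeRicci X.metric p = Matrix.diagonal ![2 / 3 * X.density p,
      X.density p / 3 * X.a p ^ 2, X.density p / 3 * X.b p ^ 2] := by
  ext i j
  rw [traceFreeRicci, ricci_eq hp, scalarCurvature_eq hp, metric_apply]
  fin_cases i <;> fin_cases j <;> simp [eta, proj, scale] <;> ring

/-! ### Covariant derivatives in the orthonormal frame -/

/-- The derivative along the `c`-th vector `e_c = (scale c)⁻¹ ∂_c` of the orthonormal frame. -/
def orthDeriv (X : Spacetime) (c : Fin 3) (f : Pt → ℝ) (p : Pt) : ℝ := pd c f p / X.scale c p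

/-- The components of a covariant tensor field in the orthonormal frame. -/
def orth (X : Spacetime) {n : ℕ} (T : TensorField n) (J : Fin n → Fin 3) (p : Pt) : ℝ :=
  T p J / ∏ i, X.scale (J i) p

/-- The connection coefficients of the orthonormal frame of a spacetime. -/
def om (X : Spacetime) (d c b : Fin 3) (p : Pt) : ℝ :=
  connCoeff (X.expX p) (X.expY p) (X.rotX p) (X.rotY p) d c b

lemma om_eq (hp : p ∈ X.U) (d c b : Fin 3) :
    X.om d c b p = X.scale d p / (X.scale c p * X.scale b p) * christoffel X.metric d c b p
      - if d = b then pd c (X.scale b) p / (X.scale c p * X.scale b p) else 0 := by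
  have ha := a_ne hp
  have hb := b_ne hp
  have e0 : X.scale 0 = fun _ => 1 := rfl
  have e1 : X.scale 1 = X.a := rfl
  have e2 : X.scale 2 = X.b := rfl
  rw [christoffel_eq hp]
  fin_cases d <;> fin_cases c <;> fin_cases b <;>
    simp [om, connCoeff, chr, e0, e1, e2, pd0_a hp, pd1_a hp, pd2_a hp, pd0_b hp,
      pd1_b hp, pd2_b hp] <;> field_simp <;> ring

lemma pd_prod_scale (hp : p ∈ X.U) {ι : Type*} (s : Finset ι) (J : ι → Fin 3) (c : Fin 3) :
    DifferentiableAt ℝ (fun q => ∏ i ∈ s, X.scale (J i) q) p ∧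
    pd c (fun q => ∏ i ∈ s, X.scale (J i) q) p
      = (∏ i ∈ s, X.scale (J i) p) * ∑ i ∈ s, pd c (X.scale (J i)) p / X.scale (J i) p := by
  classical
  induction s using Finset.induction_on with
  | empty => simp
  | insert i s hi ih =>
    have h1 := (smooth_scale (X := X) (J i)).diff hp
    have h2 := scale_ne hp (J i)
    simp only [Finset.prod_insert hi, Finset.sum_insert hi]
    refine ⟨h1.fun_mul ih.1, ?_⟩
    rw [pd_mul c h1 ih.1, ih.2]
    field_simp

lemma prod_scale_ne (hp : p ∈ X.U) {n : ℕ} (J : Fin n → Fin 3) :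
    ∏ i, X.scale (J i) p ≠ 0 := Finset.prod_ne_zero_iff.2 fun i _ => scale_ne hp (J i)

lemma prod_scale_update (hp : p ∈ X.U) {n : ℕ} (J : Fin n → Fin 3) (k : Fin n) (d : Fin 3) :
    ∏ i, X.scale (Function.update J k d i) p
      = (∏ i, X.scale (J i) p) * X.scale d p / X.scale (J k) p := by
  have h := scale_ne hp (J k)
  rw [← Finset.mul_prod_erase Finset.univ (fun i => X.scale (J i) p) (Finset.mem_univ k),
    ← Finset.mul_prod_erase Finset.univ _ (Finset.mem_univ k)]
  have : ∏ i ∈ Finset.univ.erase k, X.scale (Function.update J k d i) p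
      = ∏ i ∈ Finset.univ.erase k, X.scale (J i) p := by
    refine Finset.prod_congr rfl fun i hi => ?_
    rw [Function.update_of_ne (Finset.ne_of_mem_erase hi)]
  rw [this, Function.update_self]
  field_simp

/-- The covariant derivative in the orthonormal frame: frame derivative of the components, corrected
by the connection coefficients of the frame. -/
lemma orth_covDeriv (hp : p ∈ X.U) {n : ℕ} {T : TensorField n}
    (hT : ∀ J, DifferentiableAt ℝ (fun q => T q J) p) (J : Fin (n + 1) → Fin 3) :
    X.orth (covDeriv X.metric T) J p
      = X.orthDeriv (J (Fin.last n)) (X.orth T (Fin.init J)) p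
        - ∑ k : Fin n, ∑ d : Fin 3, X.om d (J (Fin.last n)) (Fin.init J k) p
          * X.orth T (Function.update (Fin.init J) k d) p := by
  set c := J (Fin.last n) with hc
  set I : Fin n → Fin 3 := Fin.init J with hI
  have hs := scale_ne hp c
  have hP := prod_scale_ne hp I
  obtain ⟨hd, hpd⟩ := pd_prod_scale hp Finset.univ I c
  have hprod : ∏ i, X.scale (J i) p = (∏ i, X.scale (I i) p) * X.scale c p := by
    rw [Fin.prod_univ_castSucc]; rfl
  have e1 : X.orthDeriv c (X.orth T I) p = pd c (fun q => T q I) p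
        / ((∏ i, X.scale (I i) p) * X.scale c p)
      - ∑ k, pd c (X.scale (I k)) p / (X.scale c p * X.scale (I k) p) * X.orth T I p := by
    have : pd c (X.orth T I) p = _ := pd_div c (hT I) hd hP
    rw [orthDeriv, this, hpd, ← Finset.sum_mul]
    have : ∑ k, pd c (X.scale (I k)) p / (X.scale c p * X.scale (I k) p)
        = (∑ k, pd c (X.scale (I k)) p / X.scale (I k) p) / X.scale c p := by
      rw [Finset.sum_div]
      refine Finset.sum_congr rfl fun k _ => ?_
      have := scale_ne hp (I k)
      field_simp
    rw [this, orth]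
    field_simp
  have e2 : ∀ k, ∑ d : Fin 3, X.om d c (I k) p * X.orth T (Function.update I k d) p
      = (∑ d : Fin 3, christoffel X.metric d c (I k) p * T p (Function.update I k d))
        / ((∏ i, X.scale (I i) p) * X.scale c p)
      - pd c (X.scale (I k)) p / (X.scale c p * X.scale (I k) p) * X.orth T I p := by
    intro k
    have hk := scale_ne hp (I k)
    have : ∀ d, X.om d c (I k) p * X.orth T (Function.update I k d) p
        = christoffel X.metric d c (I k) p * T p (Function.update I k d)
          / ((∏ i, X.scale (I i) p) * X.scale c p)
        - if d = I k then
          pd c (X.scale (I k)) p / (X.scale c p * X.scale (I k) p) * X.orth T I p else 0 := by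
      intro d
      have hd' := scale_ne hp d
      rw [om_eq hp, orth, prod_scale_update hp]
      split_ifs with h
      · subst h
        rw [Function.update_eq_self, orth]
        field_simp
      · field_simp
        ring
    simp only [this, Finset.sum_sub_distrib, Finset.sum_div, Finset.sum_ite_eq',
      Finset.mem_univ, if_true]
  simp only [e1, e2, Finset.sum_sub_distrib]
  rw [orth, covDeriv, hprod, ← Finset.sum_div]
  simp only [← hc, ← hI]
  ring

end Spacetime

/-! ### First and second derivatives of the curvature -/

/-- The covariant derivative `u_{i;j} = diag (0, h, k)` of the dust velocity. -/
def gradVel (h k : ℝ) (i j : Fin 3) : ℝ := if i = j then ![0, h, k] i else 0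

/-- The covariant components of the dust velocity `∂_t`. -/
def vel (i : Fin 3) : ℝ := if i = 0 then -1 else 0

/-- The covariant derivative in the direction `e` of the projection `proj = eta + vel ⊗ vel`. -/
def gradProj (h k : ℝ) (e a c : Fin 3) : ℝ :=
  gradVel h k a e * vel c + vel a * gradVel h k c e

/-- The components in the orthonormal frame of the first covariant derivative of the curvature. -/
def dustRiemDeriv (h k ρ : ℝ) (dρ : Fin 3 → ℝ) (J : Fin 5 → Fin 3) : ℝ :=
  dρ (J 4) * (proj (J 0) (J 2) * proj (J 1) (J 3) - proj (J 0) (J 3) * proj (J 1) (J 2))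
    + ρ * (gradProj h k (J 4) (J 0) (J 2) * proj (J 1) (J 3)
      + proj (J 0) (J 2) * gradProj h k (J 4) (J 1) (J 3)
      - gradProj h k (J 4) (J 0) (J 3) * proj (J 1) (J 2)
      - proj (J 0) (J 3) * gradProj h k (J 4) (J 1) (J 2))

lemma connCoeff_eta (h k r s : ℝ) (e a c : Fin 3) :
    ∑ d, (connCoeff h k r s d e a * eta d c + connCoeff h k r s d e c * eta a d) = 0 := by
  rw [Fin.sum_univ_three]
  fin_cases e <;> fin_cases a <;> fin_cases c <;> simp [connCoeff, eta]

/-- The rotation coefficients `r`, `s` drop out of the derivative of the projection, as it is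
invariant under rotations of the `x, y` plane. -/
lemma connCoeff_proj (h k r s : ℝ) (e a c : Fin 3) :
    ∑ d, (connCoeff h k r s d e a * proj d c + connCoeff h k r s d e c * proj a d)
      = -gradProj h k e a c := by
  rw [Fin.sum_univ_three]
  fin_cases e <;> fin_cases a <;> fin_cases c <;>
    simp [connCoeff, proj, gradProj, gradVel, vel]

lemma connCoeff_dustRiem (Λ ρ h k r s : ℝ) (e : Fin 3) (I : Fin 4 → Fin 3) :
    ∑ i, ∑ d, connCoeff h k r s d e (I i) * dustRiem Λ ρ (Function.update I i d)
      = -ρ * (gradProj h k e (I 0) (I 2) * proj (I 1) (I 3)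
      + proj (I 0) (I 2) * gradProj h k e (I 1) (I 3)
      - gradProj h k e (I 0) (I 3) * proj (I 1) (I 2)
      - proj (I 0) (I 3) * gradProj h k e (I 1) (I 2)) := by
  have hη := connCoeff_eta h k r s e
  have hP := connCoeff_proj h k r s e
  simp only [Fin.sum_univ_three] at hη hP
  simp only [Fin.sum_univ_four, Fin.sum_univ_three, dustRiem, Function.update_apply]
  simp only [Fin.reduceEq, if_true, if_false]
  linear_combination Λ * (eta (I 1) (I 3) * hη (I 0) (I 2) + eta (I 0) (I 2) * hη (I 1) (I 3)
    - eta (I 1) (I 2) * hη (I 0) (I 3) - eta (I 0) (I 3) * hη (I 1) (I 2))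
    + ρ * (proj (I 1) (I 3) * hP (I 0) (I 2) + proj (I 0) (I 2) * hP (I 1) (I 3)
    - proj (I 1) (I 2) * hP (I 0) (I 3) - proj (I 0) (I 3) * hP (I 1) (I 2))

namespace Spacetime

variable {X : Spacetime} {p : Pt}

lemma orthDeriv_congr {f g : Pt → ℝ} (h : ∀ q ∈ X.U, f q = g q) (hp : p ∈ X.U) (c : Fin 3) :
    X.orthDeriv c f p = X.orthDeriv c g p := by
  simp only [orthDeriv, pd_congr h hp c]

lemma Smooth.orthDeriv {f : Pt → ℝ} (hf : X.Smooth f) (c : Fin 3) :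
    X.Smooth (X.orthDeriv c f) :=
  (hf.pd c).div (smooth_scale c) fun _ hp => scale_ne hp c

lemma smooth_prod_scale {n : ℕ} (J : Fin n → Fin 3) : X.Smooth fun q => ∏ i, X.scale (J i) q :=
  contDiffOn_prod fun i _ => smooth_scale (J i)

lemma smooth_of_orth {n : ℕ} {T : TensorField n} {J : Fin n → Fin 3}
    (h : X.Smooth (X.orth T J)) : X.Smooth fun q => T q J := by
  refine (h.mul (smooth_prod_scale J)).congr fun q hq => ?_
  have := prod_scale_ne hq J
  rw [orth]; field_simp

lemma orth_riemann (hp : p ∈ X.U) (J : Fin 4 → Fin 3) :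
    X.orth (riemann X.metric) J p = dustRiem X.Λ (X.density p) J := by
  have := prod_scale_ne hp J
  rw [orth, riemann_eq hp]; field_simp

lemma smooth_dustRiem (J : Fin 4 → Fin 3) :
    X.Smooth fun q => dustRiem X.Λ (X.density q) J := by
  exact contDiffOn_const.add (smooth_density.mul contDiffOn_const)

lemma smooth_riemann (J : Fin 4 → Fin 3) : X.Smooth fun q => riemann X.metric q J :=
  smooth_of_orth ((smooth_dustRiem J).congr fun _ hq => orth_riemann hq J)

lemma orthDeriv_mul (hp : p ∈ X.U) {f g : Pt → ℝ} (hf : X.Smooth f) (hg : X.Smooth g)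
    (c : Fin 3) : X.orthDeriv c (fun q => f q * g q) p
      = X.orthDeriv c f p * g p + f p * X.orthDeriv c g p := by
  simp only [orthDeriv, pd_mul c (hf.diff hp) (hg.diff hp)]; ring

lemma orthDeriv_add (hp : p ∈ X.U) {f g : Pt → ℝ} (hf : X.Smooth f) (hg : X.Smooth g)
    (c : Fin 3) : X.orthDeriv c (fun q => f q + g q) p
      = X.orthDeriv c f p + X.orthDeriv c g p := by
  simp only [orthDeriv, pd_add c (hf.diff hp) (hg.diff hp)]; ring

@[simp] lemma orthDeriv_const (c : Fin 3) (x : ℝ) : X.orthDeriv c (fun _ => x) p = 0 := by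
  simp [orthDeriv]

lemma orthDeriv_dustRiem (hp : p ∈ X.U) (c : Fin 3) (J : Fin 4 → Fin 3) :
    X.orthDeriv c (fun q => dustRiem X.Λ (X.density q) J) p = X.orthDeriv c X.density p
      * (proj (J 0) (J 2) * proj (J 1) (J 3) - proj (J 0) (J 3) * proj (J 1) (J 2)) := by
  simp only [dustRiem]
  rw [orthDeriv_add hp contDiffOn_const (smooth_density.mul contDiffOn_const),
    orthDeriv_mul hp smooth_density contDiffOn_const]
  simp

/-- The first covariant derivative of the curvature; it does not involve the rotation
coefficients. -/
lemma orth_covDeriv_riemann (hp : p ∈ X.U) (J : Fin 5 → Fin 3) :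
    X.orth (covDeriv X.metric (riemann X.metric)) J p
      = dustRiemDeriv (X.expX p) (X.expY p) (X.density p)
        (fun c => X.orthDeriv c X.density p) J := by
  rw [orth_covDeriv hp (fun J => (smooth_riemann J).diff hp),
    orthDeriv_congr (fun q hq => orth_riemann hq _) hp, orthDeriv_dustRiem hp]
  simp only [orth_riemann hp, om]
  rw [connCoeff_dustRiem]
  simp only [dustRiemDeriv, Fin.init]
  simp only [Fin.reduceLast, Fin.castSucc_zero, Fin.reduceCastSucc]
  ring

lemma smooth_dustRiemDeriv (J : Fin 5 → Fin 3) :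
    X.Smooth fun q => dustRiemDeriv (X.expX q) (X.expY q) (X.density q)
        (fun c => X.orthDeriv c X.density q) J := by
  have h4 : ∀ i j, X.Smooth fun q => gradVel (X.expX q) (X.expY q) i j := by
    intro i j
    unfold gradVel
    split_ifs
    · fin_cases i
      · exact contDiffOn_const
      · exact smooth_expX
      · exact smooth_expY
    · exact contDiffOn_const
  have h5 : ∀ e i j, X.Smooth fun q => gradProj (X.expX q) (X.expY q) e i j := fun e i j =>
    ((h4 i e).mul contDiffOn_const).add (contDiffOn_const.mul (h4 j e))
  exact ((smooth_density.orthDeriv (J 4)).mul contDiffOn_const).add (smooth_density.mul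
    (((((h5 _ _ _).mul contDiffOn_const).add (contDiffOn_const.mul (h5 _ _ _))).sub
      ((h5 _ _ _).mul contDiffOn_const)).sub (contDiffOn_const.mul (h5 _ _ _))))

lemma smooth_covDeriv_riemann (J : Fin 5 → Fin 3) :
    X.Smooth fun q => covDeriv X.metric (riemann X.metric) q J :=
  smooth_of_orth ((smooth_dustRiemDeriv J).congr fun _ hq => orth_covDeriv_riemann hq J)

lemma orth_covDeriv_covDeriv_riemann (hp : p ∈ X.U) (J : Fin 6 → Fin 3) :
    X.orth (covDeriv X.metric (covDeriv X.metric (riemann X.metric))) J p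
      = X.orthDeriv (J 5) (fun q => dustRiemDeriv (X.expX q) (X.expY q) (X.density q)
        (fun c => X.orthDeriv c X.density q) (Fin.init J)) p
        - ∑ i : Fin 5, ∑ d : Fin 3, X.om d (J 5) (J i.castSucc) p
          * dustRiemDeriv (X.expX p) (X.expY p) (X.density p)
        (fun c => X.orthDeriv c X.density p) (Function.update (Fin.init J) i d) := by
  rw [orth_covDeriv hp (fun J => (smooth_covDeriv_riemann J).diff hp),
    orthDeriv_congr (fun q hq => orth_covDeriv_riemann hq _) hp]
  simp only [orth_covDeriv_riemann hp]
  rfl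


/-! ### Selected components -/

/-- The components of `∇ᵏ Riem` in the orthonormal frame. -/
def orthCurv (X : Spacetime) (k : ℕ) (J : Fin (4 + k) → Fin 3) (p : Pt) : ℝ :=
  X.orth (curvatureDeriv X.metric k) J p

lemma orthCurv_zero (hp : p ∈ X.U) (J : Fin 4 → Fin 3) :
    X.orthCurv 0 J p = dustRiem X.Λ (X.density p) J := orth_riemann hp J

lemma orthCurv_one (hp : p ∈ X.U) (J : Fin 5 → Fin 3) :
    X.orthCurv 1 J p = dustRiemDeriv (X.expX p) (X.expY p) (X.density p)
        (fun c => X.orthDeriv c X.density p) J := orth_covDeriv_riemann hp J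

lemma orthCurv_two (hp : p ∈ X.U) (J : Fin 6 → Fin 3) :
    X.orthCurv 2 J p = X.orthDeriv (J 5) (fun q => dustRiemDeriv (X.expX q) (X.expY q)
        (X.density q) (fun c => X.orthDeriv c X.density q) (Fin.init J)) p
        - ∑ i : Fin 5, ∑ d : Fin 3, X.om d (J 5) (J i.castSucc) p
          * dustRiemDeriv (X.expX p) (X.expY p) (X.density p)
        (fun c => X.orthDeriv c X.density p) (Function.update (Fin.init J) i d) :=
  orth_covDeriv_covDeriv_riemann hp J

/-- The Hessian of the density is read off from the components `R_{1212;cd}`. -/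
lemma orthCurv_two_1212 (hp : p ∈ X.U) (c d : Fin 3) :
    X.orthCurv 2 ![1, 2, 1, 2, c, d] p = X.orthDeriv d (X.orthDeriv c X.density) p
      - (∑ e, X.om e d c p * X.orthDeriv e X.density p)
      + 2 * X.density p * (gradVel (X.expX p) (X.expY p) 1 c * gradVel (X.expX p) (X.expY p) 1 d
        + gradVel (X.expX p) (X.expY p) 2 c * gradVel (X.expX p) (X.expY p) 2 d) := by
  have e : X.orthDeriv d (fun q => dustRiemDeriv (X.expX q) (X.expY q) (X.density q)
      (fun c => X.orthDeriv c X.density q) (Fin.init ![1, 2, 1, 2, c, d])) p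
      = X.orthDeriv d (X.orthDeriv c X.density) p := by
    refine orthDeriv_congr (fun q hq => ?_) hp d
    simp [dustRiemDeriv, Fin.init, proj, gradProj, vel]
  rw [orthCurv_two hp]
  have e5 : (![1, 2, 1, 2, c, d] : Fin 6 → Fin 3) 5 = d := rfl
  rw [e5, e]
  simp only [Fin.sum_univ_five, Fin.sum_univ_three]
  fin_cases c <;> fin_cases d <;>
    simp [dustRiemDeriv, Fin.init, proj, gradProj, vel, gradVel, om, connCoeff] <;> ring

lemma orthDeriv_zero_expX (hp : p ∈ X.U) : X.orthDeriv 0 X.expX p = X.Λ - X.expX p ^ 2 := by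
  rw [orthDeriv, pd0_expX hp]; simp [scale]

lemma orthDeriv_zero_expY (hp : p ∈ X.U) : X.orthDeriv 0 X.expY p = X.Λ - X.expY p ^ 2 := by
  rw [orthDeriv, pd0_expY hp]; simp [scale]

lemma orthDeriv_one_expX (hp : p ∈ X.U) : X.orthDeriv 1 X.expX p = 0 := by
  rw [orthDeriv, pd1_expX hp]; simp

lemma orthDeriv_one_expY (hp : p ∈ X.U) :
    X.orthDeriv 1 X.expY p = X.rotY p * (X.expX p - X.expY p) := by
  have := a_ne hp
  rw [orthDeriv, pd1_expY hp]; simp [scale]; field_simp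

lemma orthDeriv_two_expX (hp : p ∈ X.U) :
    X.orthDeriv 2 X.expX p = X.rotX p * (X.expY p - X.expX p) := by
  have := b_ne hp
  rw [orthDeriv, pd2_expX hp]; simp [scale]; field_simp

lemma orthDeriv_zero_density (hp : p ∈ X.U) :
    X.orthDeriv 0 X.density p = -X.density p * (X.expX p + X.expY p) := by
  rw [orthDeriv, pd0_density hp]; simp [scale]

lemma orthDeriv_neg (c : Fin 3) (f : Pt → ℝ) (p : Pt) :
    X.orthDeriv c (fun q => -f q) p = -X.orthDeriv c f p := by
  simp only [orthDeriv, pd_neg]; ring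

/-- This component determines the rotation coefficient `a_{,y} / (a b)`. -/
lemma orthCurv_two_021212 (hp : p ∈ X.U) :
    X.orthCurv 2 ![0, 2, 1, 2, 1, 2] p = -(X.expX p * X.orthDeriv 2 X.density p)
      - X.density p * X.rotX p * (X.expY p - X.expX p) := by
  have e : X.orthDeriv 2 (fun q => dustRiemDeriv (X.expX q) (X.expY q) (X.density q)
      (fun c => X.orthDeriv c X.density q) (Fin.init ![0, 2, 1, 2, 1, 2])) p
      = X.orthDeriv 2 (fun q => -(X.density q * X.expX q)) p := by
    refine orthDeriv_congr (fun q hq => ?_) hp 2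
    simp [dustRiemDeriv, Fin.init, proj, gradProj, vel, gradVel]
  rw [orthCurv_two hp]
  have e5 : (![0, 2, 1, 2, 1, 2] : Fin 6 → Fin 3) 5 = 2 := rfl
  rw [e5, e, orthDeriv_neg, orthDeriv_mul hp smooth_density smooth_expX, orthDeriv_two_expX hp]
  simp only [Fin.sum_univ_five, Fin.sum_univ_three]
  simp [dustRiemDeriv, Fin.init, proj, gradProj, vel, gradVel, om, connCoeff]
  ring

/-- This component determines the rotation coefficient `b_{,x} / (a b)`. -/
lemma orthCurv_two_011221 (hp : p ∈ X.U) :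
    X.orthCurv 2 ![0, 1, 1, 2, 2, 1] p = X.expY p * X.orthDeriv 1 X.density p
      + X.density p * X.rotY p * (X.expX p - X.expY p) := by
  have e : X.orthDeriv 1 (fun q => dustRiemDeriv (X.expX q) (X.expY q) (X.density q)
      (fun c => X.orthDeriv c X.density q) (Fin.init ![0, 1, 1, 2, 2, 1])) p
      = X.orthDeriv 1 (fun q => X.density q * X.expY q) p := by
    refine orthDeriv_congr (fun q hq => ?_) hp 1
    simp [dustRiemDeriv, Fin.init, proj, gradProj, vel, gradVel]
  rw [orthCurv_two hp]
  have e5 : (![0, 1, 1, 2, 2, 1] : Fin 6 → Fin 3) 5 = 1 := rfl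
  rw [e5, e, orthDeriv_mul hp smooth_density smooth_expY, orthDeriv_one_expY hp]
  simp only [Fin.sum_univ_five, Fin.sum_univ_three]
  simp [dustRiemDeriv, Fin.init, proj, gradProj, vel, gradVel, om, connCoeff]
  ring

/-- This component determines the derivative of the expansion rate `b_{,t} / b` along `∂_y`. -/
lemma orthCurv_two_011222 (hp : p ∈ X.U) :
    X.orthCurv 2 ![0, 1, 1, 2, 2, 2] p = 2 * X.expY p * X.orthDeriv 2 X.density p
      + X.density p * X.orthDeriv 2 X.expY p := by
  have e : X.orthDeriv 2 (fun q => dustRiemDeriv (X.expX q) (X.expY q) (X.density q)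
      (fun c => X.orthDeriv c X.density q) (Fin.init ![0, 1, 1, 2, 2, 2])) p
      = X.orthDeriv 2 (fun q => X.density q * X.expY q) p := by
    refine orthDeriv_congr (fun q hq => ?_) hp 2
    simp [dustRiemDeriv, Fin.init, proj, gradProj, vel, gradVel]
  rw [orthCurv_two hp]
  have e5 : (![0, 1, 1, 2, 2, 2] : Fin 6 → Fin 3) 5 = 2 := rfl
  rw [e5, e, orthDeriv_mul hp smooth_density smooth_expY]
  simp only [Fin.sum_univ_five, Fin.sum_univ_three]
  simp [dustRiemDeriv, Fin.init, proj, gradProj, vel, gradVel, om, connCoeff]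
  ring

/-! ### The null triad -/

/-- The matrix of the null triad with respect to the orthonormal frame. -/
def nullMat : Matrix (Fin 3) (Fin 3) ℚ := !![1/2, -1/2, 0; 0, 0, 1/2; 1/2, 1/2, 0]

/-- The matrix of the dual null coframe with respect to the orthonormal coframe. -/
def nullCoMat : Matrix (Fin 3) (Fin 3) ℚ := !![1, -1, 0; 0, 0, 2; 1, 1, 0]

lemma nullCoMat_transpose_mul : nullCoMat.transpose * nullMat = 1 := by
  ext i j
  fin_cases i <;> fin_cases j <;>
    simp [nullCoMat, nullMat, Matrix.mul_apply, Fin.sum_univ_three] <;> norm_num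

lemma frame_eq (v i : Fin 3) (p : Pt) : X.frame v p i = nullMat v i / X.scale i p := by
  fin_cases v <;> fin_cases i <;> simp [frame, nullMat, scale] <;> ring

lemma coframe_eq (v i : Fin 3) (p : Pt) : X.coframe v p i = nullCoMat v i * X.scale i p := by
  fin_cases v <;> fin_cases i <;> simp [coframe, nullCoMat, scale]

lemma frameDeriv_eq (c : Fin 3) (f : Pt → ℝ) (p : Pt) :
    X.frameDeriv c f p = ∑ i, (nullMat c i : ℝ) * X.orthDeriv i f p := by
  rw [frameDeriv, fderiv_apply_eq_sum_pd]
  refine Finset.sum_congr rfl fun i _ => ?_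
  rw [frame_eq, orthDeriv]; ring

/-- The connection coefficients of the null triad, which is a constant linear combination of the
orthonormal frame. -/
lemma conn_eq (hp : p ∈ X.U) (a b c : Fin 3) :
    X.conn a b c p = ∑ i, (nullCoMat a i : ℝ) * ∑ j, (nullMat c j : ℝ) *
      ∑ k, (nullMat b k : ℝ) * X.om i j k p := by
  rw [conn]
  refine Finset.sum_congr rfl fun i _ => ?_
  rw [coframe_eq, mul_assoc, Finset.mul_sum]
  congr 1
  refine Finset.sum_congr rfl fun j _ => ?_
  have hi := scale_ne hp i
  have hj := scale_ne hp j
  have e : pd j (fun q => X.frame b q i) p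
      = -(nullMat b i : ℝ) * pd j (X.scale i) p / X.scale i p ^ 2 := by
    simp only [frame_eq]
    rw [pd_div j (differentiableAt_const _) ((smooth_scale i).diff hp) hi, pd_const]
    ring
  have e2 : ∀ k, (nullMat b k : ℝ) * X.om i j k p
      = X.scale i p / X.scale j p * (christoffel X.metric i j k p * X.frame b p k)
      - if i = k then (nullMat b i : ℝ) * pd j (X.scale i) p / (X.scale j p * X.scale i p)
        else 0 := by
    intro k
    have hk := scale_ne hp k
    rw [om_eq hp, frame_eq]
    split_ifs with h
    · subst h; field_simp
    · field_simp; ring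
  simp only [e2, Finset.sum_sub_distrib, Finset.sum_ite_eq, Finset.mem_univ, if_true,
    ← Finset.mul_sum]
  rw [e, frame_eq]
  field_simp
  ring

lemma cartan_eq (k : ℕ) (J : Fin (4 + k) → Fin 3) (p : Pt) :
    X.cartan k J p = ∑ I : Fin (4 + k) → Fin 3,
      X.orthCurv k I p * ∏ i, (nullMat (J i) (I i) : ℝ) := by
  rw [cartan]
  refine Finset.sum_congr rfl fun I _ => ?_
  simp only [frame_eq, Finset.prod_div_distrib, orthCurv, orth]
  ring

/-- The components in the orthonormal frame, recovered from those in the null triad. -/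
lemma orthCurv_eq_sum_cartan (k : ℕ) (K : Fin (4 + k) → Fin 3) (p : Pt) :
    X.orthCurv k K p = ∑ J : Fin (4 + k) → Fin 3,
      X.cartan k J p * ∏ i, (nullCoMat (J i) (K i) : ℝ) := by
  have hδ : ∀ I : Fin (4 + k) → Fin 3, ∑ J : Fin (4 + k) → Fin 3,
      (∏ i, (nullMat (J i) (I i) : ℝ)) * ∏ i, (nullCoMat (J i) (K i) : ℝ)
      = if I = K then 1 else 0 := by
    intro I
    simp only [← Finset.prod_mul_distrib]
    rw [← Fintype.prod_sum (fun i j => (nullMat j (I i) : ℝ) * (nullCoMat j (K i) : ℝ))]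
    have h1 : ∀ i, ∑ j, (nullMat j (I i) : ℝ) * (nullCoMat j (K i) : ℝ)
        = if I i = K i then 1 else 0 := by
      intro i
      have h := congrFun (congrFun nullCoMat_transpose_mul (K i)) (I i)
      rw [Matrix.mul_apply, Matrix.one_apply] at h
      have h2 : ((∑ j, nullMat j (I i) * nullCoMat j (K i) : ℚ) : ℝ)
          = ((if I i = K i then 1 else 0 : ℚ) : ℝ) := by
        congr 1
        simp only [Matrix.transpose_apply] at h
        rw [← Finset.sum_congr rfl fun j _ => mul_comm _ _] at h
        rw [h]; simp only [eq_comm]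
      rw [apply_ite (Rat.cast : ℚ → ℝ)] at h2
      push_cast at h2
      exact h2
    simp only [h1]
    split_ifs with h
    · simp [h]
    · obtain ⟨i, hi⟩ := Function.ne_iff.1 h
      exact Finset.prod_eq_zero (Finset.mem_univ i) (if_neg hi)
  simp only [cartan_eq, Finset.sum_mul]
  rw [Finset.sum_comm]
  simp only [mul_assoc, ← Finset.mul_sum, hδ]
  simp

lemma spin_eq (hp : p ∈ X.U) :
    X.spinκ p = X.rotX p / 4 ∧ X.spinσ p = (X.rotY p - X.expY p) / 4 ∧
    X.spinτ p = -X.rotX p / 4 ∧ X.spinε p = X.expX p / 4 ∧ X.spinα p = 0 ∧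
    X.spinγ p = -X.expX p / 4 ∧ X.spinπ p = X.rotX p / 4 ∧
    X.spinlam p = (X.rotY p + X.expY p) / 4 ∧ X.spinν p = -X.rotX p / 4 := by
  refine ⟨?_, ?_, ?_, ?_, ?_, ?_, ?_, ?_, ?_⟩ <;>
    simp only [spinκ, spinσ, spinτ, spinε, spinα, spinγ, spinπ, spinlam, spinν, conn_eq hp,
      Fin.sum_univ_three] <;>
    simp [nullMat, nullCoMat, om, connCoeff] <;> ring

lemma Psi_eq (hp : p ∈ X.U) :
    X.Ψ 0 p = X.density p / 4 ∧ X.Ψ 1 p = 0 ∧ X.Ψ 2 p = X.density p / 12 ∧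
    X.Ψ 3 p = 0 ∧ X.Ψ 4 p = X.density p / 4 := by
  have ha := a_ne hp
  have hb := b_ne hp
  refine ⟨?_, ?_, ?_, ?_, ?_⟩ <;>
    simp [Ψ, tfRicciFrame, traceFreeRicci_eq hp, frame, dotProduct, Matrix.mulVec_diagonal,
      Fin.sum_univ_three] <;> field_simp <;> ring

end Spacetime

/-! ### Universal polynomials and rational functions -/

section Universal

variable {σ : Type*} {β : σ → Spacetime → Pt → ℝ} {s t : Set σ} {φ ψ : Spacetime → Pt → ℝ}

/-- The scalar `φ` is, on the domains of all spacetimes, the same polynomial with rational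
coefficients in the scalars `β i`, `i ∈ s`. -/
def UnivPoly (β : σ → Spacetime → Pt → ℝ) (s : Set σ) (φ : Spacetime → Pt → ℝ) : Prop :=
  ∃ P ∈ MvPolynomial.supported ℚ s, ∀ X : Spacetime, ∀ p ∈ X.U,
    φ X p = MvPolynomial.aeval (fun i => β i X p) P

/-- The scalar `φ` is the same rational function of the scalars `β i`, `i ∈ s`, for all spacetimes,
with a denominator that does not vanish where `Ψ₂ ≠ 0`. -/
def UnivRat (β : σ → Spacetime → Pt → ℝ) (s : Set σ) (φ : Spacetime → Pt → ℝ) : Prop :=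
  ∃ N D, UnivPoly β s N ∧ UnivPoly β s D ∧ ∀ X : Spacetime, ∀ p ∈ X.U, X.Ψ 2 p ≠ 0 →
    D X p ≠ 0 ∧ φ X p * D X p = N X p

namespace UnivPoly

lemma congr (h : UnivPoly β s φ) (e : ∀ X : Spacetime, ∀ p ∈ X.U, ψ X p = φ X p) :
    UnivPoly β s ψ :=
  let ⟨P, hP, h⟩ := h
  ⟨P, hP, fun X p hp => (e X p hp).trans (h X p hp)⟩

lemma mono (hst : s ⊆ t) (h : UnivPoly β s φ) : UnivPoly β t φ :=
  let ⟨P, hP, h⟩ := h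
  ⟨P, MvPolynomial.supported_mono hst hP, h⟩

lemma gen {i : σ} (hi : i ∈ s) : UnivPoly β s (β i) :=
  ⟨MvPolynomial.X i, MvPolynomial.X_mem_supported.2 hi, fun X p _ => by simp⟩

lemma const (r : ℚ) : UnivPoly β s fun _ _ => (r : ℝ) :=
  ⟨MvPolynomial.C r, Subalgebra.algebraMap_mem _ r, fun X p _ => by simp⟩

lemma add (h : UnivPoly β s φ) (h' : UnivPoly β s ψ) :
    UnivPoly β s fun X p => φ X p + ψ X p :=
  let ⟨P, hP, h⟩ := h
  let ⟨Q, hQ, h'⟩ := h'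
  ⟨P + Q, Subalgebra.add_mem _ hP hQ, fun X p hp => by simp only [h X p hp, h' X p hp, map_add]⟩

lemma mul (h : UnivPoly β s φ) (h' : UnivPoly β s ψ) :
    UnivPoly β s fun X p => φ X p * ψ X p :=
  let ⟨P, hP, h⟩ := h
  let ⟨Q, hQ, h'⟩ := h'
  ⟨P * Q, Subalgebra.mul_mem _ hP hQ, fun X p hp => by simp only [h X p hp, h' X p hp, map_mul]⟩

lemma const_mul (r : ℚ) (h : UnivPoly β s φ) : UnivPoly β s fun X p => (r : ℝ) * φ X p :=
  (const r).mul h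

lemma neg (h : UnivPoly β s φ) : UnivPoly β s fun X p => -φ X p :=
  (h.const_mul (-1)).congr fun _ _ _ => by push_cast; ring

lemma sub (h : UnivPoly β s φ) (h' : UnivPoly β s ψ) :
    UnivPoly β s fun X p => φ X p - ψ X p :=
  (h.add h'.neg).congr fun _ _ _ => sub_eq_add_neg _ _

lemma sum {ι : Type*} (S : Finset ι) {φ : ι → Spacetime → Pt → ℝ}
    (h : ∀ i ∈ S, UnivPoly β s (φ i)) : UnivPoly β s fun X p => ∑ i ∈ S, φ i X p := by
  classical
  induction S using Finset.induction_on with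
  | empty => simpa using const (β := β) (s := s) 0
  | insert i S hi ih =>
    refine ((h i (Finset.mem_insert_self _ _)).add
      (ih fun j hj => h j (Finset.mem_insert_of_mem hj))).congr fun X p _ => ?_
    rw [Finset.sum_insert hi]

/-- A frame derivative maps polynomials in scalars whose frame derivatives are polynomials to
polynomials. -/
lemma orthDeriv (c : Fin 3) (hst : s ⊆ t) (hβ : ∀ i ∈ s, ∀ X : Spacetime, X.Smooth (β i X))
    (hd : ∀ i ∈ s, UnivPoly β t fun X => X.orthDeriv c (β i X)) (h : UnivPoly β s φ) :
    UnivPoly β t fun X => X.orthDeriv c (φ X) := by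
  obtain ⟨P, hP, h⟩ := h
  have key : (∀ X : Spacetime, X.Smooth fun p => MvPolynomial.aeval (fun i => β i X p) P) ∧
      UnivPoly β t fun X =>
        X.orthDeriv c fun p => MvPolynomial.aeval (fun i => β i X p) P := by
    rw [MvPolynomial.supported_eq_adjoin_X] at hP
    clear h
    induction hP using Algebra.adjoin_induction with
    | mem x hx =>
      obtain ⟨i, hi, rfl⟩ := hx
      simp only [MvPolynomial.aeval_X]
      exact ⟨hβ i hi, hd i hi⟩
    | algebraMap r =>
      simp only [AlgHom.commutes]
      refine ⟨fun X => contDiffOn_const, (const 0).congr fun X p _ => ?_⟩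
      simp
    | add x y hx hy ihx ihy =>
      simp only [map_add]
      exact ⟨fun X => (ihx.1 X).add (ihy.1 X), (ihx.2.add ihy.2).congr fun X p hp =>
        Spacetime.orthDeriv_add hp (ihx.1 X) (ihy.1 X) c⟩
    | mul x y hx hy ihx ihy =>
      simp only [map_mul]
      refine ⟨fun X => (ihx.1 X).mul (ihy.1 X), ?_⟩
      have hx' : UnivPoly β t fun X p => MvPolynomial.aeval (fun i => β i X p) x :=
        ⟨x, MvPolynomial.supported_mono hst hx, fun _ _ _ => rfl⟩
      have hy' : UnivPoly β t fun X p => MvPolynomial.aeval (fun i => β i X p) y :=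
        ⟨y, MvPolynomial.supported_mono hst hy, fun _ _ _ => rfl⟩
      exact ((ihx.2.mul hy').add (hx'.mul ihy.2)).congr fun X p hp =>
        Spacetime.orthDeriv_mul hp (ihx.1 X) (ihy.1 X) c
  exact key.2.congr fun X p hp => Spacetime.orthDeriv_congr (h X) hp c

lemma frameDeriv {c : Fin 3} (h : ∀ i, UnivPoly β s fun X => X.orthDeriv i (φ X)) :
    UnivPoly β s fun X => X.frameDeriv c (φ X) :=
  (sum Finset.univ fun i _ => (h i).const_mul (Spacetime.nullMat c i)).congr fun X p _ =>
    Spacetime.frameDeriv_eq c (φ X) p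

end UnivPoly

namespace UnivRat

lemma of_poly (h : UnivPoly β s φ) : UnivRat β s φ :=
  ⟨φ, _, h, UnivPoly.const 1, fun X p _ _ => by simp⟩

lemma congr (h : UnivRat β s φ)
    (e : ∀ X : Spacetime, ∀ p ∈ X.U, X.Ψ 2 p ≠ 0 → ψ X p = φ X p) : UnivRat β s ψ :=
  let ⟨N, D, hN, hD, h⟩ := h
  ⟨N, D, hN, hD, fun X p hp h0 => ⟨(h X p hp h0).1, by rw [e X p hp h0, (h X p hp h0).2]⟩⟩

lemma mono (hst : s ⊆ t) (h : UnivRat β s φ) : UnivRat β t φ :=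
  let ⟨N, D, hN, hD, h⟩ := h
  ⟨N, D, hN.mono hst, hD.mono hst, h⟩

lemma add (h : UnivRat β s φ) (h' : UnivRat β s ψ) :
    UnivRat β s fun X p => φ X p + ψ X p := by
  obtain ⟨N, D, hN, hD, h⟩ := h
  obtain ⟨N', D', hN', hD', h'⟩ := h'
  refine ⟨_, _, (hN.mul hD').add (hN'.mul hD), hD.mul hD', fun X p hp h0 => ?_⟩
  obtain ⟨a, b⟩ := h X p hp h0
  obtain ⟨a', b'⟩ := h' X p hp h0
  refine ⟨mul_ne_zero a a', ?_⟩
  rw [← b, ← b']; ring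

lemma mul (h : UnivRat β s φ) (h' : UnivRat β s ψ) :
    UnivRat β s fun X p => φ X p * ψ X p := by
  obtain ⟨N, D, hN, hD, h⟩ := h
  obtain ⟨N', D', hN', hD', h'⟩ := h'
  refine ⟨_, _, hN.mul hN', hD.mul hD', fun X p hp h0 => ?_⟩
  obtain ⟨a, b⟩ := h X p hp h0
  obtain ⟨a', b'⟩ := h' X p hp h0
  refine ⟨mul_ne_zero a a', ?_⟩
  rw [← b, ← b']; ring

lemma const_mul (r : ℚ) (h : UnivRat β s φ) : UnivRat β s fun X p => (r : ℝ) * φ X p :=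
  (of_poly (UnivPoly.const r)).mul h

lemma sub (h : UnivRat β s φ) (h' : UnivRat β s ψ) :
    UnivRat β s fun X p => φ X p - ψ X p :=
  (h.add (h'.const_mul (-1))).congr fun X p _ _ => by push_cast; ring

lemma div (h : UnivRat β s φ) (h' : UnivRat β s ψ)
    (hψ : ∀ X : Spacetime, ∀ p ∈ X.U, X.Ψ 2 p ≠ 0 → ψ X p ≠ 0) :
    UnivRat β s fun X p => φ X p / ψ X p := by
  obtain ⟨N, D, hN, hD, h⟩ := h
  obtain ⟨N', D', hN', hD', h'⟩ := h'
  refine ⟨_, _, hN.mul hD', hD.mul hN', fun X p hp h0 => ?_⟩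
  obtain ⟨a, b⟩ := h X p hp h0
  obtain ⟨a', b'⟩ := h' X p hp h0
  have hne := hψ X p hp h0
  refine ⟨mul_ne_zero a (b' ▸ mul_ne_zero hne a'), ?_⟩
  simp only
  rw [← b, ← b']
  field_simp

end UnivRat

end Universal

/-! ### The basic invariants in terms of the orthonormal frame -/

namespace Spacetime

variable {X : Spacetime} {p : Pt}

lemma orthDeriv_const_mul (hp : p ∈ X.U) {f : Pt → ℝ} (hf : X.Smooth f) (c : Fin 3) (r : ℝ) :
    X.orthDeriv c (fun q => r * f q) p = r * X.orthDeriv c f p := by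
  rw [orthDeriv_mul hp contDiffOn_const hf]; simp

lemma frameDeriv_one (f : Pt → ℝ) (p : Pt) : X.frameDeriv 1 f p = X.orthDeriv 2 f p / 2 := by
  simp [frameDeriv_eq, Fin.sum_univ_three, nullMat]; ring

lemma frameDeriv_two (f : Pt → ℝ) (p : Pt) :
    X.frameDeriv 2 f p = (X.orthDeriv 0 f p + X.orthDeriv 1 f p) / 2 := by
  simp [frameDeriv_eq, Fin.sum_univ_three, nullMat]; ring

lemma spinγ_eq (hp : p ∈ X.U) : X.spinγ p = -X.expX p / 4 := by
  obtain ⟨-, -, -, -, -, h, -⟩ := spin_eq hp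
  exact h

lemma spinσ_sub (hp : p ∈ X.U) : (X.spinσ - X.spinlam) p = -(1 / 2) * X.expY p := by
  obtain ⟨-, h1, -, -, -, -, -, h2, -⟩ := spin_eq hp
  simp only [Pi.sub_apply, h1, h2]; ring

lemma spinσ_add (hp : p ∈ X.U) : (X.spinσ + X.spinlam) p = X.rotY p / 2 := by
  obtain ⟨-, h1, -, -, -, -, -, h2, -⟩ := spin_eq hp
  simp only [Pi.add_apply, h1, h2]; ring

lemma Psi_two_eq (hp : p ∈ X.U) : X.Ψ 2 p = 1 / 12 * X.density p := by
  rw [(Psi_eq hp).2.2.1]; ring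

lemma orthDeriv_Psi_two (hp : p ∈ X.U) (c : Fin 3) :
    X.orthDeriv c (X.Ψ 2) p = 1 / 12 * X.orthDeriv c X.density p := by
  rw [orthDeriv_congr (fun q hq => Psi_two_eq hq) hp, orthDeriv_const_mul hp smooth_density]

lemma frameDeriv_one_Psi (hp : p ∈ X.U) :
    X.frameDeriv 1 (X.Ψ 2) p = 1 / 24 * X.orthDeriv 2 X.density p := by
  rw [frameDeriv_one, orthDeriv_Psi_two hp]; ring

lemma frameDeriv_two_Psi (hp : p ∈ X.U) :
    X.frameDeriv 2 (X.Ψ 2) p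
      = 1 / 24 * (X.orthDeriv 0 X.density p + X.orthDeriv 1 X.density p) := by
  rw [frameDeriv_two, orthDeriv_Psi_two hp, orthDeriv_Psi_two hp]; ring

lemma orthDeriv_frameDeriv_one_Psi (hp : p ∈ X.U) (c : Fin 3) :
    X.orthDeriv c (X.frameDeriv 1 (X.Ψ 2)) p
      = 1 / 24 * X.orthDeriv c (X.orthDeriv 2 X.density) p := by
  rw [orthDeriv_congr (fun q hq => frameDeriv_one_Psi hq) hp,
    orthDeriv_const_mul hp (smooth_density.orthDeriv 2)]

lemma orthDeriv_frameDeriv_two_Psi (hp : p ∈ X.U) (c : Fin 3) :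
    X.orthDeriv c (X.frameDeriv 2 (X.Ψ 2)) p
      = 1 / 24 * (X.orthDeriv c (X.orthDeriv 0 X.density) p
        + X.orthDeriv c (X.orthDeriv 1 X.density) p) := by
  have h0 := (smooth_density (X := X)).orthDeriv 0
  have h1 := (smooth_density (X := X)).orthDeriv 1
  rw [orthDeriv_congr (fun q hq => frameDeriv_two_Psi hq) hp,
    orthDeriv_const_mul hp (by exact h0.add h1), orthDeriv_add hp h0 h1]

lemma orthDeriv_spinσ_sub (hp : p ∈ X.U) (c : Fin 3) :
    X.orthDeriv c (X.spinσ - X.spinlam) p = -(1 / 2) * X.orthDeriv c X.expY p := by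
  rw [orthDeriv_congr (fun q hq => spinσ_sub hq) hp, orthDeriv_const_mul hp smooth_expY]

lemma orthDeriv_spinγ (hp : p ∈ X.U) (c : Fin 3) :
    X.orthDeriv c X.spinγ p = -(1 / 4) * X.orthDeriv c X.expX p := by
  rw [orthDeriv_congr (g := fun q => -(1 / 4) * X.expX q)
    (fun q hq => by rw [spinγ_eq hq]; ring) hp, orthDeriv_const_mul hp smooth_expX]

/-- The torsion-free condition in the orthonormal frame. -/
lemma orthDeriv_comm (hp : p ∈ X.U) {f : Pt → ℝ} (hf : X.Smooth f) (c d : Fin 3) :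
    X.orthDeriv c (X.orthDeriv d f) p - X.orthDeriv d (X.orthDeriv c f) p
      = X.orthDeriv c f p * (pd d (X.scale c) p / (X.scale c p * X.scale d p))
        - X.orthDeriv d f p * (pd c (X.scale d) p / (X.scale c p * X.scale d p)) := by
  have hc := scale_ne hp c
  have hd := scale_ne hp d
  have e : ∀ c d, X.orthDeriv c (X.orthDeriv d f) p
      = (pd c (pd d f) p * X.scale d p - pd d f p * pd c (X.scale d) p) / X.scale d p ^ 2
        / X.scale c p := by
    intro c d
    have : pd c (X.orthDeriv d f) p = _ :=
      pd_div c ((hf.pd d).diff hp) ((smooth_scale d).diff hp) (scale_ne hp d)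
    rw [orthDeriv, this]
  rw [e, e, pd_comm X.isOpen_U hf hp c d]
  simp only [orthDeriv]
  field_simp
  ring

lemma orthDeriv_zero_one (hp : p ∈ X.U) {f : Pt → ℝ} (hf : X.Smooth f) :
    X.orthDeriv 0 (X.orthDeriv 1 f) p
      = X.orthDeriv 1 (X.orthDeriv 0 f) p - X.expX p * X.orthDeriv 1 f p := by
  have h := orthDeriv_comm hp hf 0 1
  have ha := a_ne hp
  have e0 : X.scale 0 = fun _ => 1 := rfl
  have e1 : X.scale 1 = X.a := rfl
  rw [e0, e1, pd_const, pd0_a hp] at h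
  field_simp at h
  refine mul_right_cancel₀ ha ?_
  linear_combination h

lemma orthDeriv_zero_two (hp : p ∈ X.U) {f : Pt → ℝ} (hf : X.Smooth f) :
    X.orthDeriv 0 (X.orthDeriv 2 f) p
      = X.orthDeriv 2 (X.orthDeriv 0 f) p - X.expY p * X.orthDeriv 2 f p := by
  have h := orthDeriv_comm hp hf 0 2
  have hb := b_ne hp
  have e0 : X.scale 0 = fun _ => 1 := rfl
  have e2 : X.scale 2 = X.b := rfl
  rw [e0, e2, pd_const, pd0_b hp] at h
  field_simp at h
  refine mul_right_cancel₀ hb ?_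
  linear_combination h

lemma orthDeriv_two_one (hp : p ∈ X.U) {f : Pt → ℝ} (hf : X.Smooth f) :
    X.orthDeriv 2 (X.orthDeriv 1 f) p
      = X.orthDeriv 1 (X.orthDeriv 2 f) p - X.rotX p * X.orthDeriv 1 f p
        + X.rotY p * X.orthDeriv 2 f p := by
  have h := orthDeriv_comm hp hf 2 1
  have ha := a_ne hp
  have hb := b_ne hp
  have e1 : X.scale 1 = X.a := rfl
  have e2 : X.scale 2 = X.b := rfl
  rw [e1, e2, pd2_a hp, pd1_b hp] at h
  field_simp at h
  linear_combination h

lemma orthDeriv_orthDeriv_zero_density (hp : p ∈ X.U) (c : Fin 3) :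
    X.orthDeriv c (X.orthDeriv 0 X.density) p
      = -X.orthDeriv c X.density p * (X.expX p + X.expY p)
        - X.density p * (X.orthDeriv c X.expX p + X.orthDeriv c X.expY p) := by
  have h1 := smooth_density (X := X)
  have h2 := smooth_expX (X := X)
  have h3 := smooth_expY (X := X)
  rw [orthDeriv_congr (g := fun q => -(X.density q * (X.expX q + X.expY q)))
    (fun q hq => by rw [orthDeriv_zero_density hq]; ring) hp, orthDeriv_neg,
    orthDeriv_mul hp h1 (by exact h2.add h3), orthDeriv_add hp h2 h3]
  ring

end Spacetime

/-! ### Polynomials in the basic invariants -/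

/-- Universal polynomials in the first `n` of the twelve basic invariants. -/
abbrev BasicPoly (n : ℕ) (φ : Spacetime → Pt → ℝ) : Prop :=
  UnivPoly (fun (i : Fin 12) X => X.basic i) {i | i.val < n} φ

/-- Universal rational functions of the Cartan invariants of order at most `n`. -/
abbrev CartanRat (n : ℕ) (φ : Spacetime → Pt → ℝ) : Prop :=
  UnivRat (fun (j : CurvIndex) X => X.cartan j.1 j.2) {j | j.1 ≤ n} φ

open Spacetime

section ConstantTensors

variable {σ : Type*} {β : σ → Spacetime → Pt → ℝ} {s : Set σ}

lemma UnivPoly.ite (P : Prop) [Decidable P] {φ ψ : Spacetime → Pt → ℝ} (h : UnivPoly β s φ)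
    (h' : UnivPoly β s ψ) : UnivPoly β s fun X p => if P then φ X p else ψ X p := by
  split_ifs <;> assumption

lemma UnivPoly.zero : UnivPoly β s fun _ _ => 0 := by simpa using UnivPoly.const (β := β) (s := s) 0

lemma UnivPoly.one : UnivPoly β s fun _ _ => 1 := by simpa using UnivPoly.const (β := β) (s := s) 1

lemma univPoly_eta (i j : Fin 3) : UnivPoly β s fun _ _ => eta i j :=
  .ite _ (.ite _ (by simpa using UnivPoly.const (β := β) (s := s) (-1)) .one) .zero

lemma univPoly_proj (i j : Fin 3) : UnivPoly β s fun _ _ => proj i j :=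
  .ite _ (.ite _ .zero .one) .zero

lemma univPoly_vel (i : Fin 3) : UnivPoly β s fun _ _ => vel i :=
  .ite _ (by simpa using UnivPoly.const (β := β) (s := s) (-1)) .zero

lemma univPoly_gradVel {h k : Spacetime → Pt → ℝ} (hh : UnivPoly β s h) (hk : UnivPoly β s k)
    (i j : Fin 3) : UnivPoly β s fun X p => gradVel (h X p) (k X p) i j := by
  refine .ite _ ?_ .zero
  fin_cases i
  · exact .zero
  · exact hh
  · exact hk

lemma univPoly_connCoeff {h k r r' : Spacetime → Pt → ℝ} (hh : UnivPoly β s h)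
    (hk : UnivPoly β s k) (hr : UnivPoly β s r) (hr' : UnivPoly β s r') (d c b : Fin 3) :
    UnivPoly β s fun X p => connCoeff (h X p) (k X p) (r X p) (r' X p) d c b := by
  fin_cases d <;> fin_cases c <;> fin_cases b <;>
    first | exact .zero | exact hh | exact hk | exact hr | exact hr' | exact hr.neg | exact hr'.neg

lemma univPoly_dustRiem {L ρ : Spacetime → Pt → ℝ} (hL : UnivPoly β s L) (hρ : UnivPoly β s ρ)
    (I : Fin 4 → Fin 3) : UnivPoly β s fun X p => dustRiem (L X p) (ρ X p) I :=
  (hL.mul (((univPoly_eta _ _).mul (univPoly_eta _ _)).sub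
    ((univPoly_eta _ _).mul (univPoly_eta _ _)))).add
  (hρ.mul (((univPoly_proj _ _).mul (univPoly_proj _ _)).sub
    ((univPoly_proj _ _).mul (univPoly_proj _ _))))

lemma univPoly_dustRiemDeriv {h k ρ : Spacetime → Pt → ℝ} {dρ : Fin 3 → Spacetime → Pt → ℝ}
    (hh : UnivPoly β s h) (hk : UnivPoly β s k) (hρ : UnivPoly β s ρ)
    (hdρ : ∀ c, UnivPoly β s (dρ c)) (J : Fin 5 → Fin 3) :
    UnivPoly β s fun X p => dustRiemDeriv (h X p) (k X p) (ρ X p) (fun c => dρ c X p) J := by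
  have hG : ∀ e a c, UnivPoly β s fun X p => gradProj (h X p) (k X p) e a c := fun e a c =>
    ((univPoly_gradVel hh hk a e).mul (univPoly_vel c)).add
      ((univPoly_vel a).mul (univPoly_gradVel hh hk c e))
  have hP := univPoly_proj (β := β) (s := s)
  exact ((hdρ _).mul (((hP _ _).mul (hP _ _)).sub ((hP _ _).mul (hP _ _)))).add
    (hρ.mul (((((hG _ _ _).mul (hP _ _)).add ((hP _ _).mul (hG _ _ _))).sub
      ((hG _ _ _).mul (hP _ _))).sub ((hP _ _).mul (hG _ _ _))))

end ConstantTensors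

section BasicPoly

lemma BasicPoly.mono {m n : ℕ} (hmn : m ≤ n) {φ : Spacetime → Pt → ℝ} (h : BasicPoly m φ) :
    BasicPoly n φ :=
  UnivPoly.mono (fun _ hi => lt_of_lt_of_le hi hmn) h

lemma basicPoly_basic {n : ℕ} (i : Fin 12) (hi : i.val < n) : BasicPoly n fun X => X.basic i :=
  UnivPoly.gen (β := fun (i : Fin 12) X => X.basic i) hi

lemma basicPoly_Λ : BasicPoly 2 fun X _ => X.Λ := basicPoly_basic 0 (by decide)

lemma basicPoly_density : BasicPoly 2 fun X => X.density :=
  (UnivPoly.const_mul 12 (basicPoly_basic 1 (by decide))).congr fun X p hp => by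
    change _ = _ * X.Ψ 2 p
    rw [Psi_two_eq hp]; push_cast; ring

lemma basicPoly_expX : BasicPoly 6 fun X => X.expX :=
  (UnivPoly.const_mul (-4) (basicPoly_basic 2 (by decide))).congr fun X p hp => by
    change _ = _ * X.spinγ p
    rw [spinγ_eq hp]; push_cast; ring

lemma basicPoly_expY : BasicPoly 6 fun X => X.expY :=
  (UnivPoly.const_mul (-2) (basicPoly_basic 3 (by decide))).congr fun X p hp => by
    change _ = _ * (X.spinσ - X.spinlam) p
    rw [spinσ_sub hp]; push_cast; ring

lemma basicPoly_orthDeriv_density (c : Fin 3) :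
    BasicPoly 6 fun X => X.orthDeriv c X.density := by
  have h0 : BasicPoly 6 fun X => X.orthDeriv 0 X.density :=
    ((basicPoly_density.mono (by norm_num)).neg.mul (basicPoly_expX.add basicPoly_expY)).congr
      fun X p hp => orthDeriv_zero_density hp
  fin_cases c
  · exact h0
  · refine ((UnivPoly.const_mul 24 (basicPoly_basic 5 (by decide))).sub h0).congr
      fun X p hp => ?_
    change X.orthDeriv 1 X.density p = _ * X.frameDeriv 2 (X.Ψ 2) p - _
    rw [frameDeriv_two_Psi hp]; push_cast; ring
  · refine (UnivPoly.const_mul 24 (basicPoly_basic 4 (by decide))).congr fun X p hp => ?_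
    change X.orthDeriv 2 X.density p = _ * X.frameDeriv 1 (X.Ψ 2) p
    rw [frameDeriv_one_Psi hp]; push_cast; ring

lemma basicPoly_rotX : BasicPoly 12 fun X => X.rotX :=
  (UnivPoly.const_mul 4 (basicPoly_basic 6 (by decide))).congr fun X p hp => by
    change _ = _ * X.spinπ p
    obtain ⟨-, -, -, -, -, -, h, -⟩ := spin_eq hp
    rw [h]; push_cast; ring

lemma basicPoly_rotY : BasicPoly 12 fun X => X.rotY :=
  (UnivPoly.const_mul 2 (basicPoly_basic 7 (by decide))).congr fun X p hp => by
    change _ = _ * (X.spinσ + X.spinlam) p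
    rw [spinσ_add hp]; push_cast; ring

lemma basicPoly_orthDeriv_expX (c : Fin 3) : BasicPoly 12 fun X => X.orthDeriv c X.expX := by
  have hΛ := basicPoly_Λ.mono (show 2 ≤ 12 by norm_num)
  have hh := basicPoly_expX.mono (show 6 ≤ 12 by norm_num)
  have hk := basicPoly_expY.mono (show 6 ≤ 12 by norm_num)
  fin_cases c
  · exact (hΛ.sub (hh.mul hh)).congr fun X p hp => (orthDeriv_zero_expX hp).trans (by ring)
  · exact UnivPoly.zero.congr fun X p hp => orthDeriv_one_expX hp
  · exact (basicPoly_rotX.mul (hk.sub hh)).congr fun X p hp => orthDeriv_two_expX hp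

lemma basicPoly_orthDeriv_expY (c : Fin 3) : BasicPoly 12 fun X => X.orthDeriv c X.expY := by
  have hΛ := basicPoly_Λ.mono (show 2 ≤ 12 by norm_num)
  have hh := basicPoly_expX.mono (show 6 ≤ 12 by norm_num)
  have hk := basicPoly_expY.mono (show 6 ≤ 12 by norm_num)
  fin_cases c
  · exact (hΛ.sub (hk.mul hk)).congr fun X p hp => (orthDeriv_zero_expY hp).trans (by ring)
  · exact (basicPoly_rotY.mul (hh.sub hk)).congr fun X p hp => orthDeriv_one_expY hp
  · refine (UnivPoly.const_mul (-4) (basicPoly_basic 8 (by decide))).congr fun X p hp => ?_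
    change X.orthDeriv 2 X.expY p = _ * X.frameDeriv 1 (X.spinσ - X.spinlam) p
    rw [frameDeriv_one, orthDeriv_spinσ_sub hp]; push_cast; ring

/-- Three of the second derivatives of the density are given by basic invariants; those in which
the derivative along `e₀` occurs, and the opposite mixed one, follow from the conservation of the
dust and the commutators of the frame. -/
lemma basicPoly_orthDeriv_orthDeriv_density (c d : Fin 3) :
    BasicPoly 12 fun X => X.orthDeriv c (X.orthDeriv d X.density) := by
  have hh := basicPoly_expX.mono (show 6 ≤ 12 by norm_num)
  have hk := basicPoly_expY.mono (show 6 ≤ 12 by norm_num)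
  have hρ := basicPoly_density.mono (show 2 ≤ 12 by norm_num)
  have hd := fun c => (basicPoly_orthDeriv_density c).mono (show 6 ≤ 12 by norm_num)
  have h0 : ∀ c, BasicPoly 12 fun X => X.orthDeriv c (X.orthDeriv 0 X.density) := fun c =>
    (((hd c).neg.mul (hh.add hk)).sub (hρ.mul
      ((basicPoly_orthDeriv_expX c).add (basicPoly_orthDeriv_expY c)))).congr
      fun X p hp => orthDeriv_orthDeriv_zero_density hp c
  have h01 : BasicPoly 12 fun X => X.orthDeriv 0 (X.orthDeriv 1 X.density) :=
    ((h0 1).sub (hh.mul (hd 1))).congr fun X p hp => orthDeriv_zero_one hp smooth_density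
  have h02 : BasicPoly 12 fun X => X.orthDeriv 0 (X.orthDeriv 2 X.density) :=
    ((h0 2).sub (hk.mul (hd 2))).congr fun X p hp => orthDeriv_zero_two hp smooth_density
  -- `48 = 12 * 2 * 2`: one factor from `Ψ₂ = ρ / 12`, two from the vectors `m`, `n` of the triad
  have h11 : BasicPoly 12 fun X => X.orthDeriv 1 (X.orthDeriv 1 X.density) := by
    refine ((((UnivPoly.const_mul 48 (basicPoly_basic 10 (by decide))).sub (h0 0)).sub
      h01).sub (h0 1)).congr fun X p hp => ?_
    change _ = ((48 : ℚ) : ℝ) * X.frameDeriv 2 (X.frameDeriv 2 (X.Ψ 2)) p - _ - _ - _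
    rw [frameDeriv_two, orthDeriv_frameDeriv_two_Psi hp, orthDeriv_frameDeriv_two_Psi hp]
    push_cast; ring
  have h12 : BasicPoly 12 fun X => X.orthDeriv 1 (X.orthDeriv 2 X.density) := by
    refine ((UnivPoly.const_mul 48 (basicPoly_basic 11 (by decide))).sub h02).congr
      fun X p hp => ?_
    change _ = ((48 : ℚ) : ℝ) * X.frameDeriv 2 (X.frameDeriv 1 (X.Ψ 2)) p - _
    rw [frameDeriv_two, orthDeriv_frameDeriv_one_Psi hp, orthDeriv_frameDeriv_one_Psi hp]
    push_cast; ring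
  have h22 : BasicPoly 12 fun X => X.orthDeriv 2 (X.orthDeriv 2 X.density) := by
    refine (UnivPoly.const_mul 48 (basicPoly_basic 9 (by decide))).congr fun X p hp => ?_
    change _ = ((48 : ℚ) : ℝ) * X.frameDeriv 1 (X.frameDeriv 1 (X.Ψ 2)) p
    rw [frameDeriv_one, orthDeriv_frameDeriv_one_Psi hp]
    push_cast; ring
  have h21 : BasicPoly 12 fun X => X.orthDeriv 2 (X.orthDeriv 1 X.density) :=
    ((h12.sub (basicPoly_rotX.mul (hd 1))).add (basicPoly_rotY.mul (hd 2))).congr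
      fun X p hp => orthDeriv_two_one hp smooth_density
  fin_cases d
  · exact h0 c
  · fin_cases c
    exacts [h01, h11, h21]
  · fin_cases c
    exacts [h02, h12, h22]

lemma smooth_basic (i : Fin 12) (hi : i.val < 6) (X : Spacetime) :
    X.Smooth (X.basic i) := by
  have hρ := smooth_density (X := X)
  have hd := fun c => hρ.orthDeriv (X := X) c
  obtain ⟨i, hi'⟩ := i
  simp only at hi
  interval_cases i
  · exact contDiffOn_const
  · exact ((contDiffOn_const (c := (1 / 12 : ℝ))).mul hρ).congr fun p hp => Psi_two_eq hp
  · exact (smooth_expX.neg.div_const 4).congr fun p hp => spinγ_eq hp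
  · exact ((contDiffOn_const (c := (-(1 / 2) : ℝ))).mul smooth_expY).congr
      fun p hp => spinσ_sub hp
  · exact ((contDiffOn_const (c := (1 / 24 : ℝ))).mul (hd 2)).congr
      fun p hp => frameDeriv_one_Psi hp
  · exact ((contDiffOn_const (c := (1 / 24 : ℝ))).mul ((hd 0).add (hd 1))).congr
      fun p hp => frameDeriv_two_Psi hp

/-- The frame derivatives of polynomials in the basic invariants of order at most one are
polynomials in all twelve basic invariants. -/
lemma BasicPoly.orthDeriv {φ : Spacetime → Pt → ℝ} (h : BasicPoly 6 φ) (c : Fin 3) :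
    BasicPoly 12 fun X => X.orthDeriv c (φ X) := by
  have hd := fun d => (basicPoly_orthDeriv_density d).mono (show 6 ≤ 12 by norm_num)
  have hst : {i : Fin 12 | i.val < 6} ⊆ {i : Fin 12 | i.val < 12} := fun i _ => i.isLt
  refine UnivPoly.orthDeriv c hst (fun i hi => smooth_basic i hi) ?_ h
  rintro ⟨i, hi'⟩ hi
  simp only [Set.mem_ofPred_eq] at hi
  interval_cases i
  · exact UnivPoly.zero.congr fun X p hp => orthDeriv_const c X.Λ
  · exact ((hd c).const_mul (1 / 12)).congr fun X p hp =>
      (orthDeriv_Psi_two hp c).trans (by push_cast; ring)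
  · exact ((basicPoly_orthDeriv_expX c).const_mul (-(1 / 4))).congr fun X p hp =>
      (orthDeriv_spinγ hp c).trans (by push_cast; ring)
  · exact ((basicPoly_orthDeriv_expY c).const_mul (-(1 / 2))).congr fun X p hp =>
      (orthDeriv_spinσ_sub hp c).trans (by push_cast; ring)
  · exact ((basicPoly_orthDeriv_orthDeriv_density c 2).const_mul (1 / 24)).congr
      fun X p hp => (orthDeriv_frameDeriv_one_Psi hp c).trans (by push_cast; ring)
  · exact (((basicPoly_orthDeriv_orthDeriv_density c 0).add
      (basicPoly_orthDeriv_orthDeriv_density c 1)).const_mul (1 / 24)).congr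
      fun X p hp => (orthDeriv_frameDeriv_two_Psi hp c).trans (by push_cast; ring)

/-- The order-one components need only the six basic invariants of order at most one, as the
rotation coefficients do not occur in `dustRiemDeriv`. -/
lemma basicPoly_orthCurv (k : Fin 3) (J : Fin (4 + k.val) → Fin 3) :
    BasicPoly (numBasic k.val) fun X => X.orthCurv k.val J := by
  have h1 : ∀ J : Fin 5 → Fin 3, BasicPoly 6 fun X p =>
      dustRiemDeriv (X.expX p) (X.expY p) (X.density p) (fun c => X.orthDeriv c X.density p) J :=
    univPoly_dustRiemDeriv basicPoly_expX basicPoly_expY (basicPoly_density.mono (by norm_num))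
      basicPoly_orthDeriv_density
  fin_cases k
  · exact (univPoly_dustRiem basicPoly_Λ basicPoly_density J).congr
      fun X p hp => orthCurv_zero hp J
  · exact (h1 J).congr fun X p hp => orthCurv_one hp J
  · refine (((h1 (Fin.init (n := 5) J)).orthDeriv (J 5)).sub (UnivPoly.sum Finset.univ fun i _ =>
      UnivPoly.sum Finset.univ fun d _ => ?_)).congr fun X p hp => orthCurv_two hp J
    exact (univPoly_connCoeff (basicPoly_expX.mono (by norm_num))
      (basicPoly_expY.mono (by norm_num)) basicPoly_rotX basicPoly_rotY _ _ _).mul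
      ((h1 _).mono (by norm_num))

lemma basicPoly_cartan (k : Fin 3) (J : Fin (4 + k.val) → Fin 3) :
    BasicPoly (numBasic k.val) fun X => X.cartan k.val J :=
  (UnivPoly.sum Finset.univ fun I _ => (basicPoly_orthCurv k I).mul
    (UnivPoly.const (∏ i, nullMat (J i) (I i)))).congr fun X p _ => by
      rw [cartan_eq]; push_cast; rfl

/-- The frame derivatives along the null triad of polynomials in the basic invariants of order at
most one. -/
lemma BasicPoly.frameDeriv {φ : Spacetime → Pt → ℝ} (h : BasicPoly 6 φ) (c : Fin 3) :
    BasicPoly 12 fun X => X.frameDeriv c (φ X) :=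
  UnivPoly.frameDeriv fun i => h.orthDeriv i

lemma basicPoly_frameDeriv_Psi (c : Fin 3) : BasicPoly 6 fun X => X.frameDeriv c (X.Ψ 2) :=
  UnivPoly.frameDeriv fun i => ((basicPoly_orthDeriv_density i).const_mul (1 / 12)).congr
    fun X p hp => (orthDeriv_Psi_two hp i).trans (by push_cast; ring)

lemma basicPoly_value (I : ExtInvariant) : BasicPoly (numBasic I.order) fun X => I.value X := by
  have hh := basicPoly_expX.mono (show 6 ≤ 12 by norm_num)
  have hk := basicPoly_expY.mono (show 6 ≤ 12 by norm_num)
  have hr := basicPoly_rotX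
  have hs := basicPoly_rotY
  cases I with
  | curv k J => exact basicPoly_cartan k J
  | cosm => exact basicPoly_Λ
  | psi i =>
    have hρ := basicPoly_density
    have h4 := hρ.const_mul (1 / 4)
    fin_cases i
    · exact h4.congr fun X p hp => (Psi_eq hp).1.trans (by push_cast; ring)
    · exact UnivPoly.zero.congr fun X p hp => (Psi_eq hp).2.1
    · exact basicPoly_basic 1 (by decide)
    · exact UnivPoly.zero.congr fun X p hp => (Psi_eq hp).2.2.2.1
    · exact h4.congr fun X p hp => (Psi_eq hp).2.2.2.2.trans (by push_cast; ring)
  | gamma => exact basicPoly_basic 2 (by decide)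
  | epsilon =>
    exact (basicPoly_expX.const_mul (1 / 4)).congr fun X p hp =>
      (spin_eq hp).2.2.2.1.trans (by push_cast; ring)
  | sigmaSubLam => exact basicPoly_basic 3 (by decide)
  | dPsi c => exact basicPoly_frameDeriv_Psi c
  | kappa =>
    exact (hr.const_mul (1 / 4)).congr fun X p hp => (spin_eq hp).1.trans (by push_cast; ring)
  | sigma =>
    exact ((hs.sub hk).const_mul (1 / 4)).congr fun X p hp =>
      (spin_eq hp).2.1.trans (by push_cast; ring)
  | tau =>
    exact (hr.const_mul (-(1 / 4))).congr fun X p hp =>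
      (spin_eq hp).2.2.1.trans (by push_cast; ring)
  | alpha => exact UnivPoly.zero.congr fun X p hp => (spin_eq hp).2.2.2.2.1
  | pi => exact basicPoly_basic 6 (by decide)
  | lam =>
    exact ((hs.add hk).const_mul (1 / 4)).congr fun X p hp =>
      (spin_eq hp).2.2.2.2.2.2.2.1.trans (by push_cast; ring)
  | nu =>
    exact (hr.const_mul (-(1 / 4))).congr fun X p hp =>
      (spin_eq hp).2.2.2.2.2.2.2.2.trans (by push_cast; ring)
  | dGamma c => exact BasicPoly.frameDeriv (basicPoly_basic 2 (by decide)) c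
  | dSigmaSubLam c => exact BasicPoly.frameDeriv (basicPoly_basic 3 (by decide)) c
  | ddPsi c d => exact (basicPoly_frameDeriv_Psi d).frameDeriv c

end BasicPoly

/-! ### Recovering the basic invariants from the curvature -/

section CartanRat

lemma CartanRat.mono {m n : ℕ} (hmn : m ≤ n) {φ : Spacetime → Pt → ℝ} (h : CartanRat m φ) :
    CartanRat n φ :=
  UnivRat.mono (fun _ hi => le_trans hi hmn) h

lemma cartanRat_orthCurv (k : ℕ) (K : Fin (4 + k) → Fin 3) :
    CartanRat k fun X => X.orthCurv k K := by
  refine UnivRat.of_poly ((UnivPoly.sum Finset.univ fun J _ =>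
    (UnivPoly.gen (β := fun (j : CurvIndex) X => X.cartan j.1 j.2) (s := {j | j.1 ≤ k})
      (i := ⟨k, J⟩) (by simp)).mul (UnivPoly.const (∏ i, nullCoMat (J i) (K i)))).congr
      fun X p _ => ?_)
  rw [orthCurv_eq_sum_cartan]; push_cast; rfl

lemma density_ne {X : Spacetime} {p : Pt} (hp : p ∈ X.U) (h : X.Ψ 2 p ≠ 0) :
    X.density p ≠ 0 := fun h0 => h (by rw [Psi_two_eq hp, h0, mul_zero])

lemma cartanRat_Λ : CartanRat 0 fun X _ => X.Λ :=
  ((cartanRat_orthCurv 0 ![0, 1, 0, 1]).const_mul (-1)).congr fun X p hp _ => by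
    rw [orthCurv_zero hp]; simp [dustRiem, eta, proj]

lemma cartanRat_density : CartanRat 0 fun X => X.density :=
  ((cartanRat_orthCurv 0 ![1, 2, 1, 2]).sub cartanRat_Λ).congr fun X p hp _ => by
    rw [orthCurv_zero hp]; simp [dustRiem, eta, proj]

lemma cartanRat_orthDeriv_density (c : Fin 3) : CartanRat 1 fun X => X.orthDeriv c X.density :=
  (cartanRat_orthCurv 1 ![1, 2, 1, 2, c]).congr fun X p hp _ => by
    rw [orthCurv_one hp]; simp [dustRiemDeriv, proj, gradProj, vel]

lemma cartanRat_expX : CartanRat 1 fun X => X.expX :=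
  (((cartanRat_orthCurv 1 ![0, 2, 1, 2, 1]).const_mul (-1)).div
    (cartanRat_density.mono zero_le_one) fun X p hp h => density_ne hp h).congr
    fun X p hp h => by
      have := density_ne hp h
      rw [orthCurv_one hp]; simp [dustRiemDeriv, proj, gradProj, vel, gradVel]; field_simp

lemma cartanRat_expY : CartanRat 1 fun X => X.expY :=
  ((cartanRat_orthCurv 1 ![0, 1, 1, 2, 2]).div
    (cartanRat_density.mono zero_le_one) fun X p hp h => density_ne hp h).congr
    fun X p hp h => by
      have := density_ne hp h
      rw [orthCurv_one hp]; simp [dustRiemDeriv, proj, gradProj, vel, gradVel]; field_simp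

/-- The rotation coefficient is determined because the expansion rates are different. -/
lemma cartanRat_rotX : CartanRat 2 fun X => X.rotX := by
  have hρ := cartanRat_density.mono zero_le_two
  have hh := cartanRat_expX.mono one_le_two
  have hk := cartanRat_expY.mono one_le_two
  have hd := (cartanRat_orthDeriv_density 2).mono one_le_two
  refine ((((cartanRat_orthCurv 2 ![0, 2, 1, 2, 1, 2]).add (hh.mul hd)).const_mul (-1)).div
    (hρ.mul (hk.sub hh)) fun X p hp h => mul_ne_zero (density_ne hp h) (expY_ne_expX hp)).congr
    fun X p hp h => ?_
  have h1 := density_ne hp h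
  have h2 := expY_ne_expX hp
  rw [orthCurv_two_021212 hp]
  field_simp
  push_cast
  ring

lemma cartanRat_rotY : CartanRat 2 fun X => X.rotY := by
  have hρ := cartanRat_density.mono zero_le_two
  have hh := cartanRat_expX.mono one_le_two
  have hk := cartanRat_expY.mono one_le_two
  have hd := (cartanRat_orthDeriv_density 1).mono one_le_two
  refine ((((cartanRat_orthCurv 2 ![0, 1, 1, 2, 2, 1]).sub (hk.mul hd)).const_mul (-1)).div
    (hρ.mul (hk.sub hh)) fun X p hp h => mul_ne_zero (density_ne hp h) (expY_ne_expX hp)).congr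
    fun X p hp h => ?_
  have h1 := density_ne hp h
  have h2 := expY_ne_expX hp
  rw [orthCurv_two_011221 hp]
  field_simp
  push_cast
  ring

lemma cartanRat_orthDeriv_expY : CartanRat 2 fun X => X.orthDeriv 2 X.expY := by
  have hρ := cartanRat_density.mono zero_le_two
  have hk := cartanRat_expY.mono one_le_two
  have hd := (cartanRat_orthDeriv_density 2).mono one_le_two
  refine (((cartanRat_orthCurv 2 ![0, 1, 1, 2, 2, 2]).sub ((hk.mul hd).const_mul 2)).div
    hρ fun X p hp h => density_ne hp h).congr fun X p hp h => ?_
  have h1 := density_ne hp h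
  rw [orthCurv_two_011222 hp]
  field_simp
  push_cast
  ring

lemma cartanRat_orthDeriv_orthDeriv_density_spatial :
    (CartanRat 2 fun X => X.orthDeriv 1 (X.orthDeriv 1 X.density)) ∧
    (CartanRat 2 fun X => X.orthDeriv 1 (X.orthDeriv 2 X.density)) ∧
    CartanRat 2 fun X => X.orthDeriv 2 (X.orthDeriv 2 X.density) := by
  have hρ := cartanRat_density.mono zero_le_two
  have hh := cartanRat_expX.mono one_le_two
  have hk := cartanRat_expY.mono one_le_two
  have hr := cartanRat_rotX
  have hs := cartanRat_rotY
  have hd := fun c => (cartanRat_orthDeriv_density c).mono one_le_two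
  refine ⟨?_, ?_, ?_⟩
  · refine ((((cartanRat_orthCurv 2 ![1, 2, 1, 2, 1, 1]).add (hh.mul (hd 0))).sub
      (hr.mul (hd 2))).sub ((hρ.mul (hh.mul hh)).const_mul 2)).congr fun X p hp h => ?_
    rw [orthCurv_two_1212 hp]
    simp [Fin.sum_univ_three, om, connCoeff, gradVel]
    ring
  · refine ((cartanRat_orthCurv 2 ![1, 2, 1, 2, 2, 1]).add (hr.mul (hd 1))).congr
      fun X p hp h => ?_
    rw [orthCurv_two_1212 hp]
    simp [Fin.sum_univ_three, om, connCoeff, gradVel]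
  · refine ((((cartanRat_orthCurv 2 ![1, 2, 1, 2, 2, 2]).add (hk.mul (hd 0))).sub
      (hs.mul (hd 1))).sub ((hρ.mul (hk.mul hk)).const_mul 2)).congr fun X p hp h => ?_
    rw [orthCurv_two_1212 hp]
    simp [Fin.sum_univ_three, om, connCoeff, gradVel]
    ring

lemma cartanRat_basic (i : Fin 12) : CartanRat (basicOrder i) fun X => X.basic i := by
  have hρ := cartanRat_density
  have hd := cartanRat_orthDeriv_density
  have hΛ2 := cartanRat_Λ.mono zero_le_two
  have hρ2 := cartanRat_density.mono zero_le_two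
  have hh2 := cartanRat_expX.mono one_le_two
  have hk2 := cartanRat_expY.mono one_le_two
  have hd2 := fun c => (hd c).mono one_le_two
  obtain ⟨h11, h12, h22⟩ := cartanRat_orthDeriv_orthDeriv_density_spatial
  fin_cases i
  · exact cartanRat_Λ
  · exact (hρ.const_mul (1 / 12)).congr fun X p hp _ =>
      (Psi_two_eq hp).trans (by push_cast; ring)
  · exact (cartanRat_expX.const_mul (-(1 / 4))).congr fun X p hp _ =>
      (spinγ_eq hp).trans (by push_cast; ring)
  · exact (cartanRat_expY.const_mul (-(1 / 2))).congr fun X p hp _ =>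
      (spinσ_sub hp).trans (by push_cast; ring)
  · exact ((hd 2).const_mul (1 / 24)).congr fun X p hp _ =>
      (frameDeriv_one_Psi hp).trans (by push_cast; ring)
  · exact (((hd 0).add (hd 1)).const_mul (1 / 24)).congr fun X p hp _ =>
      (frameDeriv_two_Psi hp).trans (by push_cast; ring)
  · exact (cartanRat_rotX.const_mul (1 / 4)).congr fun X p hp _ =>
      (spin_eq hp).2.2.2.2.2.2.1.trans (by push_cast; ring)
  · exact (cartanRat_rotY.const_mul (1 / 2)).congr fun X p hp _ =>
      (spinσ_add hp).trans (by push_cast; ring)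
  · exact (cartanRat_orthDeriv_expY.const_mul (-(1 / 4))).congr fun X p hp _ => by
      change X.frameDeriv 1 (X.spinσ - X.spinlam) p = _
      rw [frameDeriv_one, orthDeriv_spinσ_sub hp]; push_cast; ring
  · exact (h22.const_mul (1 / 48)).congr fun X p hp _ => by
      change X.frameDeriv 1 (X.frameDeriv 1 (X.Ψ 2)) p = _
      rw [frameDeriv_one, orthDeriv_frameDeriv_one_Psi hp]; push_cast; ring
  · -- `(e₀ + e₁)² ρ`, with the derivatives along `e₀` reduced to first order ones
    have hdiv := (hh2.add hk2)
    have hdh : CartanRat 2 fun X => X.orthDeriv 0 X.expX :=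
      (hΛ2.sub (hh2.mul hh2)).congr fun X p hp _ => (orthDeriv_zero_expX hp).trans (by ring)
    have hdk : CartanRat 2 fun X => X.orthDeriv 0 X.expY :=
      (hΛ2.sub (hk2.mul hk2)).congr fun X p hp _ => (orthDeriv_zero_expY hp).trans (by ring)
    have hdk1 : CartanRat 2 fun X => X.orthDeriv 1 X.expY :=
      (cartanRat_rotY.mul (hh2.sub hk2)).congr fun X p hp _ => orthDeriv_one_expY hp
    have h00 : CartanRat 2 fun X => X.orthDeriv 0 (X.orthDeriv 0 X.density) :=
      ((((hd2 0).const_mul (-1)).mul hdiv).sub (hρ2.mul (hdh.add hdk))).congr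
        fun X p hp _ => (orthDeriv_orthDeriv_zero_density hp 0).trans (by push_cast; ring)
    have h10 : CartanRat 2 fun X => X.orthDeriv 1 (X.orthDeriv 0 X.density) :=
      ((((hd2 1).const_mul (-1)).mul hdiv).sub (hρ2.mul hdk1)).congr
        fun X p hp _ => (orthDeriv_orthDeriv_zero_density hp 1).trans
          (by rw [orthDeriv_one_expX hp]; push_cast; ring)
    have h01 : CartanRat 2 fun X => X.orthDeriv 0 (X.orthDeriv 1 X.density) :=
      (h10.sub (hh2.mul (hd2 1))).congr
        fun X p hp _ => orthDeriv_zero_one hp smooth_density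
    exact (((h00.add h01).add (h10.add h11)).const_mul (1 / 48)).congr fun X p hp _ => by
      change X.frameDeriv 2 (X.frameDeriv 2 (X.Ψ 2)) p = _
      rw [frameDeriv_two, orthDeriv_frameDeriv_two_Psi hp, orthDeriv_frameDeriv_two_Psi hp]
      push_cast; ring
  · have hdh : CartanRat 2 fun X => X.orthDeriv 2 X.expX :=
      (cartanRat_rotX.mul (hk2.sub hh2)).congr fun X p hp _ => orthDeriv_two_expX hp
    have h20 : CartanRat 2 fun X => X.orthDeriv 2 (X.orthDeriv 0 X.density) :=
      ((((hd2 2).const_mul (-1)).mul (hh2.add hk2)).sub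
        (hρ2.mul (hdh.add cartanRat_orthDeriv_expY))).congr
        fun X p hp _ => (orthDeriv_orthDeriv_zero_density hp 2).trans (by push_cast; ring)
    have h02 : CartanRat 2 fun X => X.orthDeriv 0 (X.orthDeriv 2 X.density) :=
      (h20.sub (hk2.mul (hd2 2))).congr fun X p hp _ => orthDeriv_zero_two hp smooth_density
    exact ((h02.add h12).const_mul (1 / 48)).congr fun X p hp _ => by
      change X.frameDeriv 2 (X.frameDeriv 1 (X.Ψ 2)) p = _
      rw [frameDeriv_two, orthDeriv_frameDeriv_one_Psi hp, orthDeriv_frameDeriv_one_Psi hp]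
      push_cast; ring

end CartanRat

/-! ### One-parameter groups of matrices preserving a tensor -/

section OneParameter

open scoped Matrix.Norms.Operator

lemma hasDerivAt_exp_smul_apply (A : Matrix (Fin 3) (Fin 3) ℝ) (i j : Fin 3) :
    HasDerivAt (fun s : ℝ => NormedSpace.exp (s • A) i j) (A i j) 0 := by
  have h := hasDerivAt_exp_smul_const A (0 : ℝ)
  rw [zero_smul, NormedSpace.exp_zero, one_mul] at h
  exact ((Matrix.entryLinearMap ℝ ℝ i j).toContinuousLinearMap.hasFDerivAt.comp_hasDerivAt 0 h)

/-- Covectors annihilated by the generator are fixed by the one-parameter group. -/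
lemma mul_exp_of_mul_eq_zero {A B : Matrix (Fin 3) (Fin 3) ℝ} (h : B * A = 0) :
    B * NormedSpace.exp A = B := by
  have hd : ∀ s : ℝ, HasDerivAt (fun s : ℝ => B * NormedSpace.exp (s • A)) 0 s := by
    intro s
    have := (hasDerivAt_exp_smul_const' A s).const_mul B
    rwa [← mul_assoc, h, zero_mul] at this
  have := is_const_of_deriv_eq_zero (fun s => (hd s).differentiableAt) (fun s => (hd s).deriv) 1 0
  simpa using this

lemma exp_transpose_mul_mul_exp {A g : Matrix (Fin 3) (Fin 3) ℝ} (hg : IsUnit g.det)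
    (h : A.transpose * g = -(g * A)) :
    (NormedSpace.exp A).transpose * g * NormedSpace.exp A = g := by
  have e : A.transpose = g * (-A) * g⁻¹ := by
    rw [mul_neg, ← h, Matrix.mul_nonsing_inv_cancel_right _ _ hg]
  rw [← Matrix.exp_transpose, e, Matrix.exp_conj _ _ ((Matrix.isUnit_iff_isUnit_det g).2 hg),
    Matrix.nonsing_inv_mul_cancel_right _ _ hg, mul_assoc,
    ← Matrix.exp_add_of_commute _ _ (Commute.neg_left (Commute.refl A))]
  simp

end OneParameter

/-- All factors but the `i`-th of a component of the pull-back by the identity: they single out the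
multi-indices that differ from `I` at most in the place `i`. -/
lemma prod_erase_one_apply {n : ℕ} (I J : Fin n → Fin 3) (i : Fin n) :
    ∏ j ∈ Finset.univ.erase i, (1 : Matrix (Fin 3) (Fin 3) ℝ) (J j) (I j)
      = ∑ d, if J = Function.update I i d then 1 else 0 := by
  by_cases h : J = Function.update I i (J i)
  · rw [Finset.prod_eq_one, Finset.sum_eq_single (J i)]
    · rw [if_pos h]
    · intro d _ hd
      rw [if_neg]
      rintro h'
      exact hd (by rw [h', Function.update_self])
    · simp
    · intro j hj
      rw [h, Function.update_of_ne (Finset.ne_of_mem_erase hj), Matrix.one_apply_eq]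
  · rw [Finset.sum_eq_zero]
    · obtain ⟨j, hj⟩ := Function.ne_iff.1 h
      have hji : j ≠ i := by
        rintro rfl
        exact hj (by rw [Function.update_self])
      rw [Function.update_of_ne hji] at hj
      exact Finset.prod_eq_zero (Finset.mem_erase.2 ⟨hji, Finset.mem_univ _⟩)
        (Matrix.one_apply_ne hj)
    · intro d _
      rw [if_neg]
      rintro h'
      apply h
      have : J i = d := by rw [h', Function.update_self]
      rw [this]; exact h'

/-- The derivative at the identity of the action of a one-parameter group on a covariant tensor: the
generator acts on one index at a time. -/
lemma hasDerivAt_pullback_exp {n : ℕ} (A : Matrix (Fin 3) (Fin 3) ℝ) (T : (Fin n → Fin 3) → ℝ)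
    (I : Fin n → Fin 3) :
    HasDerivAt (fun s : ℝ => pullback (NormedSpace.exp (s • A)) T I)
      (∑ i, ∑ d, A d (I i) * T (Function.update I i d)) 0 := by
  have h : ∀ J : Fin n → Fin 3, HasDerivAt
      (fun s : ℝ => T J * ∏ k, NormedSpace.exp (s • A) (J k) (I k))
      (T J * ∑ i, (∏ j ∈ Finset.univ.erase i, NormedSpace.exp ((0 : ℝ) • A) (J j) (I j))
        • A (J i) (I i)) 0 := fun J =>
    (HasDerivAt.fun_finsetProd fun i _ => hasDerivAt_exp_smul_apply A (J i) (I i)).const_mul _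
  refine (HasDerivAt.fun_sum fun J _ => h J).congr_deriv ?_
  simp only [zero_smul, NormedSpace.exp_zero, prod_erase_one_apply, smul_eq_mul, Finset.mul_sum,
    Finset.sum_mul]
  rw [Finset.sum_comm]
  refine Finset.sum_congr rfl fun i _ => ?_
  rw [Finset.sum_comm]
  refine Finset.sum_congr rfl fun d _ => ?_
  rw [Finset.sum_eq_single (Function.update I i d)]
  · simp; ring
  · intro J _ hJ
    rw [if_neg hJ]; ring
  · simp

lemma sum_fin_succ_pi {n : ℕ} (F : (Fin (n + 1) → Fin 3) → ℝ) :
    ∑ J, F J = ∑ a, ∑ J : Fin n → Fin 3, F (Fin.cons a J) := by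
  rw [← (Fin.consEquiv fun _ => Fin 3).sum_comp, Fintype.sum_prod_type]
  rfl

/-- The pull-back of a product of two symmetric bilinear forms. -/
lemma pullback_mul (M K L : Matrix (Fin 3) (Fin 3) ℝ) (I : Fin 4 → Fin 3) :
    pullback M (fun J : Fin 4 → Fin 3 => K (J 0) (J 2) * L (J 1) (J 3)) I
      = (M.transpose * K * M) (I 0) (I 2) * (M.transpose * L * M) (I 1) (I 3) ∧
    pullback M (fun J : Fin 4 → Fin 3 => K (J 0) (J 3) * L (J 1) (J 2)) I
      = (M.transpose * K * M) (I 0) (I 3) * (M.transpose * L * M) (I 1) (I 2) := by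
  have e : ∀ (K : Matrix (Fin 3) (Fin 3) ℝ) (i j : Fin 3), (M.transpose * K * M) i j
      = ∑ a, ∑ c, K a c * M a i * M c j := by
    intro K i j
    simp only [Matrix.mul_apply, Matrix.transpose_apply, Finset.sum_mul]
    rw [Finset.sum_comm]
    exact Finset.sum_congr rfl fun a _ => Finset.sum_congr rfl fun c _ => by ring
  simp only [e, pullback, sum_fin_succ_pi, Finset.sum_mul_sum, Fin.prod_univ_four]
  constructor
  · refine Finset.sum_congr rfl fun a _ => Finset.sum_congr rfl fun b _ =>
      Finset.sum_congr rfl fun c _ => Finset.sum_congr rfl fun d _ => ?_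
    rw [Fintype.sum_unique]
    change K a c * L b d * (M a (I 0) * M b (I 1) * M c (I 2) * M d (I 3)) = _
    ring
  · refine Finset.sum_congr rfl fun a _ => Finset.sum_congr rfl fun b _ => ?_
    rw [Finset.sum_comm]
    refine Finset.sum_congr rfl fun c _ => Finset.sum_congr rfl fun d _ => ?_
    rw [Fintype.sum_unique]
    change K a c * L b d * (M a (I 0) * M b (I 1) * M d (I 2) * M c (I 3)) = _
    ring

/-! ### Isotropy groups -/

namespace Spacetime

variable {X : Spacetime} {p : Pt}

/-- The components of an endomorphism of the tangent space in the orthonormal frame. -/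
def orthEnd (X : Spacetime) (p : Pt) (A : Matrix (Fin 3) (Fin 3) ℝ) (i j : Fin 3) : ℝ :=
  A i j * X.scale i p / X.scale j p

lemma infinitesimal_isotropy_metric (hp : p ∈ X.U) {q : ℕ} {A : Matrix (Fin 3) (Fin 3) ℝ}
    (hA : ∀ s : ℝ, NormedSpace.exp (s • A) ∈ isotropyGroup X.metric q p) (i j : Fin 3) :
    eta j j * X.orthEnd p A j i + eta i i * X.orthEnd p A i j = 0 := by
  have h1 : ∀ s : ℝ, ∑ k, NormedSpace.exp (s • A) k i * (eta k k * X.scale k p ^ 2)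
      * NormedSpace.exp (s • A) k j = X.metric p i j := by
    intro s
    have h := congrFun (congrFun (hA s).1 i) j
    rw [Matrix.mul_apply] at h
    rw [← h]
    refine Finset.sum_congr rfl fun k _ => ?_
    rw [Matrix.mul_apply, Finset.sum_eq_single k]
    · rw [metric_apply, Matrix.transpose_apply]; ring
    · intro l _ hl
      rw [metric_apply, eta, if_neg hl]; ring
    · simp
  have hd := HasDerivAt.fun_sum (u := Finset.univ) fun k (_ : k ∈ Finset.univ) =>
    ((hasDerivAt_exp_smul_apply A k i).mul_const (eta k k * X.scale k p ^ 2)).fun_mul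
      (hasDerivAt_exp_smul_apply A k j)
  simp only [h1, zero_smul, NormedSpace.exp_zero] at hd
  have h0 := hd.unique (hasDerivAt_const _ _)
  rw [Finset.sum_add_distrib, Finset.sum_eq_single j (by
    intro k _ hk; rw [Matrix.one_apply_ne hk, mul_zero]) (by simp),
    Finset.sum_eq_single i (by
    intro k _ hk; rw [Matrix.one_apply_ne hk, zero_mul, zero_mul]) (by simp),
    Matrix.one_apply_eq, Matrix.one_apply_eq] at h0
  have hi := scale_ne hp i
  have hj := scale_ne hp j
  simp only [orthEnd]
  field_simp
  linear_combination h0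

lemma infinitesimal_isotropy (hp : p ∈ X.U) {q : ℕ} {A : Matrix (Fin 3) (Fin 3) ℝ}
    (hA : ∀ s : ℝ, NormedSpace.exp (s • A) ∈ isotropyGroup X.metric q p) {k : ℕ} (hk : k ≤ q)
    (I : Fin (4 + k) → Fin 3) :
    ∑ i, ∑ d, X.orthEnd p A d (I i) * X.orthCurv k (Function.update I i d) p = 0 := by
  have hd := hasDerivAt_pullback_exp A (curvatureDeriv X.metric k p) I
  have h1 : ∀ s : ℝ, pullback (NormedSpace.exp (s • A)) (curvatureDeriv X.metric k p) I
      = curvatureDeriv X.metric k p I := fun s => congrFun ((hA s).2 k hk) I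
  simp only [h1] at hd
  have h0 := hd.unique (hasDerivAt_const _ _)
  have hP := prod_scale_ne hp I
  have e : ∀ i d, X.orthEnd p A d (I i) * X.orthCurv k (Function.update I i d) p
      = A d (I i) * curvatureDeriv X.metric k p (Function.update I i d)
        / ∏ i, X.scale (I i) p := by
    intro i d
    have h2 := scale_ne hp (I i)
    have h3 := scale_ne hp d
    rw [orthEnd, orthCurv, orth, prod_scale_update hp]
    field_simp
  simp only [e, ← Finset.sum_div, h0, zero_div]

/-- The generator of the rotations of the plane orthogonal to the dust velocity. -/
def rotGen (X : Spacetime) (p : Pt) : Matrix (Fin 3) (Fin 3) ℝ :=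
  !![0, 0, 0; 0, 0, -(X.b p / X.a p); 0, X.a p / X.b p, 0]

lemma metric_det_isUnit (hp : p ∈ X.U) : IsUnit (X.metric p).det := by
  have ha := a_ne hp
  have hb := b_ne hp
  rw [metric, Matrix.det_diagonal, Fin.prod_univ_three]
  simp [ha, hb]

/-- The rotations preserve the metric and the square of the covector `dt`, and the curvature is
built from these two. -/
lemma exp_rotGen_mem (hp : p ∈ X.U) (s : ℝ) :
    NormedSpace.exp (s • X.rotGen p) ∈ isotropyGroup X.metric 0 p := by
  have ha := a_ne hp
  have hb := b_ne hp
  set M := NormedSpace.exp (s • X.rotGen p) with hM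
  have hg : M.transpose * X.metric p * M = X.metric p := by
    refine exp_transpose_mul_mul_exp (metric_det_isUnit hp) ?_
    ext i j
    fin_cases i <;> fin_cases j <;>
      simp [rotGen, metric, Matrix.mul_apply, Fin.sum_univ_three] <;> field_simp
  set E : Matrix (Fin 3) (Fin 3) ℝ := Matrix.diagonal ![1, 0, 0] with hE
  have hEM : E * M = E := by
    refine mul_exp_of_mul_eq_zero ?_
    ext i j
    fin_cases i <;> fin_cases j <;> simp [hE, rotGen, Matrix.mul_apply, Fin.sum_univ_three]
  have hME : M.transpose * E * M = E := by
    have e1 : E = E.transpose * E := by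
      rw [hE, Matrix.diagonal_transpose, Matrix.diagonal_mul_diagonal]
      congr 1; ext i; fin_cases i <;> simp
    calc M.transpose * E * M = (E * M).transpose * (E * M) := by
          conv_lhs => rw [e1]
          rw [Matrix.transpose_mul]; simp only [mul_assoc]
      _ = E := by rw [hEM, ← e1]
  -- the projection orthogonal to the velocity is the sum of two invariant forms
  have hh : M.transpose * (X.metric p + E) * M = X.metric p + E := by
    rw [mul_add, add_mul, hg, hME]
  refine ⟨hg, fun k hk => ?_⟩
  obtain rfl : k = 0 := by omega
  have hproj : ∀ i j, (X.metric p + E) i j = proj i j * (X.scale i p * X.scale j p) := by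
    intro i j
    rw [Matrix.add_apply, metric_apply]
    fin_cases i <;> fin_cases j <;> simp [eta, proj, scale, hE]
  have hR : curvatureDeriv X.metric 0 p = fun J : Fin 4 → Fin 3 =>
      X.Λ * (X.metric p (J 0) (J 2) * X.metric p (J 1) (J 3))
      - X.Λ * (X.metric p (J 0) (J 3) * X.metric p (J 1) (J 2))
      + X.density p * ((X.metric p + E) (J 0) (J 2) * (X.metric p + E) (J 1) (J 3))
      - X.density p * ((X.metric p + E) (J 0) (J 3) * (X.metric p + E) (J 1) (J 2)) := by
    funext J
    change riemann X.metric p J = _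
    rw [riemann_eq hp, dustRiem, Fin.prod_univ_four]
    simp only [hproj, metric_apply]
    ring
  funext I
  have h1 := pullback_mul M (X.metric p) (X.metric p) I
  have h2 := pullback_mul M (X.metric p + E) (X.metric p + E) I
  rw [hg] at h1
  rw [hh] at h2
  rw [hR]
  simp only [← h1.1, ← h1.2, ← h2.1, ← h2.2]
  simp only [pullback, Finset.mul_sum, ← Finset.sum_add_distrib, ← Finset.sum_sub_distrib]
  refine Finset.sum_congr rfl fun J _ => ?_
  ring

/-- At a point of non-zero density, the infinitesimal isotropies of the curvature are the rotations
of the plane orthogonal to the dust velocity. -/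
lemma infinitesimal_isotropy_zero (hp : p ∈ X.U) (hΨ : X.Ψ 2 p ≠ 0) {q : ℕ}
    {A : Matrix (Fin 3) (Fin 3) ℝ}
    (hA : ∀ s : ℝ, NormedSpace.exp (s • A) ∈ isotropyGroup X.metric q p) :
    A = X.orthEnd p A 2 1 • X.rotGen p := by
  have hρ := density_ne hp hΨ
  have ha := a_ne hp
  have hb := b_ne hp
  have hm := infinitesimal_isotropy_metric hp hA
  have h1 := infinitesimal_isotropy hp hA (Nat.zero_le q) ![0, 2, 1, 2]
  have h2 := infinitesimal_isotropy hp hA (Nat.zero_le q) ![0, 1, 2, 1]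
  have e : ∀ i j, A i j = X.orthEnd p A i j * X.scale j p / X.scale i p := by
    intro i j
    have := scale_ne hp i
    have := scale_ne hp j
    rw [orthEnd]; field_simp
  set O := X.orthEnd p A
  have m00 := hm 0 0
  have m11 := hm 1 1
  have m22 := hm 2 2
  have m01 := hm 0 1
  have m02 := hm 0 2
  have m12 := hm 1 2
  simp only [orthCurv_zero hp, Fin.sum_univ_three] at h1 h2
  rw [Fin.sum_univ_four] at h1 h2
  simp [dustRiem, eta, proj] at h1 h2 m00 m11 m22 m01 m02 m12
  have z10 : O 1 0 = 0 := by
    have : O 1 0 * X.density p = 0 := by linear_combination h1 - X.Λ * m01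
    exact (mul_eq_zero.1 this).resolve_right hρ
  have z20 : O 2 0 = 0 := by
    have : O 2 0 * X.density p = 0 := by linear_combination h2 - X.Λ * m02
    exact (mul_eq_zero.1 this).resolve_right hρ
  have z01 : O 0 1 = 0 := by linarith
  have z02 : O 0 2 = 0 := by linarith
  have z12 : O 1 2 = -O 2 1 := by linarith
  ext i j
  rw [e i j]
  fin_cases i <;> fin_cases j <;>
    simp [rotGen, scale, m00, m11, m22, z10, z20, z01, z02, z12] <;> field_simp

lemma rotGen_ne_zero (hp : p ∈ X.U) : X.rotGen p ≠ 0 := fun h => by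
  have := congrFun (congrFun h 2) 1
  simp [rotGen, a_ne hp, b_ne hp] at this

lemma isotropyDim_zero (hp : p ∈ X.U) (hΨ : X.Ψ 2 p ≠ 0) : isotropyDim X.metric 0 p = 1 := by
  have h : Submodule.span ℝ {A : Matrix (Fin 3) (Fin 3) ℝ |
      ∀ s : ℝ, NormedSpace.exp (s • A) ∈ isotropyGroup X.metric 0 p}
      = Submodule.span ℝ {X.rotGen p} := by
    apply le_antisymm
    · rw [Submodule.span_le]
      intro A hA
      exact Submodule.mem_span_singleton.2 ⟨_, (infinitesimal_isotropy_zero hp hΨ hA).symm⟩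
    · rw [Submodule.span_singleton_le_iff_mem]
      exact Submodule.subset_span fun s => exp_rotGen_mem hp s
  rw [isotropyDim, h, finrank_span_singleton (rotGen_ne_zero hp)]

/-- The expansion rates in two orthogonal directions are different, so the first derivative of the
curvature is not invariant under any rotation. -/
lemma isotropyDim_pos (hp : p ∈ X.U) (hΨ : X.Ψ 2 p ≠ 0) {q : ℕ} (hq : 1 ≤ q) :
    isotropyDim X.metric q p = 0 := by
  have h : Submodule.span ℝ {A : Matrix (Fin 3) (Fin 3) ℝ |
      ∀ s : ℝ, NormedSpace.exp (s • A) ∈ isotropyGroup X.metric q p} = ⊥ := by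
    rw [Submodule.span_eq_bot]
    intro A hA
    have h0 := infinitesimal_isotropy_zero hp hΨ hA
    have h1 := infinitesimal_isotropy hp hA hq ![0, 2, 1, 2, 2]
    have hm := infinitesimal_isotropy_metric hp hA 1 2
    have e1 : X.orthEnd p A 1 0 = 0 := by rw [h0]; simp [orthEnd, rotGen]
    have e2 : X.orthEnd p A 2 0 = 0 := by rw [h0]; simp [orthEnd, rotGen]
    have hne := expY_ne_expX hp
    have hρ := density_ne hp hΨ
    simp only [orthCurv_one hp, Fin.sum_univ_three] at h1
    rw [Fin.sum_univ_five] at h1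
    simp [dustRiemDeriv, eta, proj, gradProj, gradVel, vel, e1, e2] at h1 hm
    have h2 : X.orthEnd p A 2 1 * (X.density p * (X.expY p - X.expX p)) = 0 := by
      linear_combination X.density p * (X.expY p - X.expX p) * hm - h1
    have h3 := (mul_eq_zero.1 h2).resolve_right (mul_ne_zero hρ hne)
    rw [h0, h3, zero_smul]
  rw [isotropyDim, h, finrank_bot]

lemma isSegreDZ (hp : p ∈ X.U) (hΨ : X.Ψ 2 p ≠ 0) : IsSegreDZ X.metric p := by
  have ha := a_ne hp
  have hb := b_ne hp
  have hρ := density_ne hp hΨ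
  -- the timelike eigenvector is the dust velocity `∂_t`; the trace-free Ricci endomorphism is
  -- `(ρ / 3) diag (-2, 1, 1)`
  refine ⟨![1, 0, 0], X.density p / 3, ?_, by positivity, ?_, ?_⟩
  · simp [metric, Matrix.mulVec_diagonal, dotProduct, Fin.sum_univ_three]
  · rw [metric_inv hp, traceFreeRicci_eq hp, Matrix.diagonal_mul_diagonal]
    funext i
    rw [Matrix.mulVec_diagonal]
    fin_cases i
    · simp; ring
    · simp
    · simp
  · intro v hv
    have h0 : v 0 = 0 := by
      simpa [metric, Matrix.mulVec_diagonal, dotProduct, Fin.sum_univ_three] using hv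
    rw [metric_inv hp, traceFreeRicci_eq hp, Matrix.diagonal_mul_diagonal]
    funext i
    rw [Matrix.mulVec_diagonal]
    fin_cases i <;> simp [h0] <;> field_simp <;> simp

lemma invariantCount_le (q : ℕ) (p : Pt) : X.invariantCount q p ≤ 3 := by
  refine (Submodule.finrank_le _).trans (le_of_eq ?_)
  rw [← (LinearMap.toContinuousLinearMap (𝕜 := ℝ) (E := Pt) (F' := ℝ)).finrank_eq,
    Module.finrank_linearMap]
  simp

lemma invariantCount_mono {q q' : ℕ} (h : q ≤ q') (p : Pt) :
    X.invariantCount q p ≤ X.invariantCount q' p :=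
  Submodule.finrank_mono (Submodule.span_mono fun _ ⟨k, hk, J, hJ⟩ => ⟨k, hk.trans h, J, hJ⟩)

end Spacetime

lemma aeval_pi_apply {σ ι : Type*} (x : σ → ι → ℝ) (P : MvPolynomial σ ℚ) (p : ι) :
    MvPolynomial.aeval x P p = MvPolynomial.aeval (fun i => x i p) P :=
  MvPolynomial.comp_aeval_apply (f := x) (Pi.evalAlgHom ℚ (fun _ : ι => ℝ) p) P

/-- Polynomials in `n` variables evaluate to at most `n` algebraically independent elements. -/
lemma not_algebraicIndependent_aeval {m n : ℕ} (hmn : n < m) {A : Type*} [CommRing A]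
    [Algebra ℚ A] (x : Fin n → A) (P : Fin m → MvPolynomial (Fin n) ℚ) :
    ¬ AlgebraicIndependent ℚ fun i => MvPolynomial.aeval x (P i) := by
  intro h
  have h1 : AlgebraicIndependent ℚ P := AlgebraicIndependent.of_comp (MvPolynomial.aeval x) h
  have h2 := h1.lift_cardinalMk_le_trdeg
  rw [MvPolynomial.trdeg_of_isDomain] at h2
  simp at h2
  omega

end Szekeres3D

end

theorem mainTheorem1 :
    -- Normal form of the triad; Segre type and dimensions of the isotropy groups.
    (∀ X : Szekeres3D.Spacetime, ∀ p ∈ X.U,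
      X.Ψ 0 p = 3 * X.Ψ 2 p ∧ X.Ψ 4 p = 3 * X.Ψ 2 p ∧ X.Ψ 1 p = 0 ∧ X.Ψ 3 p = 0 ∧
      X.spinκ p = X.spinπ p ∧ X.spinτ p = -X.spinπ p ∧ X.spinν p = -X.spinπ p ∧
      X.spinε p = -X.spinγ p ∧ X.spinα p = 0) ∧
    (∀ X : Szekeres3D.Spacetime, ∀ p ∈ X.U, X.Ψ 2 p ≠ 0 →
      Szekeres3D.IsSegreDZ X.metric p ∧
      Szekeres3D.isotropyDim X.metric 0 p = 1 ∧
      Szekeres3D.isotropyDim X.metric 1 p = 0 ∧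
      Szekeres3D.isotropyDim X.metric 2 p = 0) ∧
    -- In the generic case the invariant count is (1, 3, 3) and the algorithm stops at order 2.
    (∀ X : Szekeres3D.Spacetime, (∀ p ∈ X.U, X.Ψ 2 p ≠ 0) →
      (∀ p ∈ X.U, X.invariantCount 0 p = 1) → (∀ p ∈ X.U, X.invariantCount 1 p = 3) →
      ∀ p ∈ X.U, X.invariantCount 2 p = 3 ∧ IsLeast {q : ℕ | X.StopsAt q p} 2) ∧
    -- Every (extended) Cartan invariant of order at most 2 is a universal polynomial
    -- in those of the twelve basic invariants whose order is not larger.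
    (∀ I : Szekeres3D.ExtInvariant, ∃ P : MvPolynomial (Fin 12) ℚ,
      (∀ i ∈ P.vars, i.val < Szekeres3D.numBasic I.order) ∧
      ∀ X : Szekeres3D.Spacetime, ∀ p ∈ X.U,
        I.value X p = MvPolynomial.aeval (fun i => X.basic i p) P) ∧
    -- Each of the twelve is a universal rational function of the curvature components
    -- up to its own order.
    (∀ i : Fin 12, ∃ P Q : MvPolynomial Szekeres3D.CurvIndex ℚ,
      (∀ j ∈ P.vars ∪ Q.vars, j.1 ≤ Szekeres3D.basicOrder i) ∧
      ∀ X : Szekeres3D.Spacetime, ∀ p ∈ X.U, X.Ψ 2 p ≠ 0 →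
        MvPolynomial.aeval (fun j : Szekeres3D.CurvIndex => X.cartan j.1 j.2 p) Q ≠ 0 ∧
        X.basic i p * MvPolynomial.aeval (fun j : Szekeres3D.CurvIndex => X.cartan j.1 j.2 p) Q
          = MvPolynomial.aeval (fun j : Szekeres3D.CurvIndex => X.cartan j.1 j.2 p) P) ∧
    -- At most twelve of them are algebraically independent.
    (∀ X : Szekeres3D.Spacetime, ∀ I : Fin 13 → Szekeres3D.ExtInvariant,
      ¬ AlgebraicIndependent ℚ
        (fun (i : Fin 13) (p : X.U) => (I i).value X (p : Szekeres3D.Pt))) := by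
  open Szekeres3D Spacetime in
  refine ⟨fun X p hp => ?_, fun X p hp hΨ => ⟨isSegreDZ hp hΨ, isotropyDim_zero hp hΨ,
    isotropyDim_pos hp hΨ le_rfl, isotropyDim_pos hp hΨ one_le_two⟩,
    fun X hΨ h0 h1 p hp => ?_, fun I => ?_, fun i => ?_, fun X I hI => ?_⟩
  · obtain ⟨p0, p1, p2, p3, p4⟩ := Psi_eq hp
    obtain ⟨k, -, t, e, al, g, pi, -, n⟩ := spin_eq hp
    rw [p0, p1, p2, p3, p4, k, t, e, al, g, pi, n]
    refine ⟨by ring, by ring, rfl, rfl, rfl, by ring, by ring, by ring, rfl⟩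
  · have h2 : X.invariantCount 2 p = 3 :=
      le_antisymm (invariantCount_le 2 p) (h1 p hp ▸ invariantCount_mono one_le_two p)
    refine ⟨h2, ⟨one_le_two, by rw [h2, h1 p hp], ?_⟩, fun q hq => ?_⟩
    · rw [isotropyDim_pos hp (hΨ p hp) one_le_two, isotropyDim_pos hp (hΨ p hp) le_rfl]
    · by_contra hlt
      obtain rfl : q = 1 := le_antisymm (by omega) hq.1
      have := hq.2.1
      rw [h1 p hp, h0 p hp] at this
      omega
  · obtain ⟨P, hP, h⟩ := basicPoly_value I
    exact ⟨P, fun i hi => MvPolynomial.mem_supported.1 hP hi, h⟩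
  · obtain ⟨N, D, ⟨P, hP, hN⟩, ⟨Q, hQ, hD⟩, h⟩ := cartanRat_basic i
    refine ⟨P, Q, fun j hj => ?_, fun X p hp hΨ => ?_⟩
    · rcases Finset.mem_union.1 hj with hj | hj
      · exact MvPolynomial.mem_supported.1 hP hj
      · exact MvPolynomial.mem_supported.1 hQ hj
    · rw [← hN X p hp, ← hD X p hp]
      exact h X p hp hΨ
  · choose P _ hP using fun i => basicPoly_value (I i)
    refine not_algebraicIndependent_aeval (show 12 < 13 by norm_num)
      (fun i (p : X.U) => X.basic i p) P ?_
    have e : (fun (i : Fin 13) (p : X.U) => (I i).value X (p : Pt))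
        = fun i => MvPolynomial.aeval (fun j (p : X.U) => X.basic j p) (P i) := by
      funext i p
      rw [aeval_pi_apply]
      exact hP i X p p.2
    rw [← e]
    exact hI
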